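/- **Setting.** Fix a horizon $T\ge 0$, a delay $d>0$, and $r,a_0,a_1,\sigma\in\mathbb R$, $b_0\ge 0$, $b_1\in L^2([-d,0];\mathbb R^+)$, $\alpha_0,\alpha_1,\beta_0,\beta_1,\lambda_0,\lambda_1\in\mathbb R$, $\gamma_0,\gamma_1>0$. Let $W$ be a real Brownian motion on a complete probability space $(\Omega,\mathcal F,\mathbb P)$, let $(\mathcal F_t)_{t\ge0}$ be the augmentation of the filtration generated by $W$, and let $\mathcal U$ be the set of real-valued progressively measurable processes in $L^2(\Omega\times[0,T])$. Let $H=\mathbb R^2\times L^2([-d,0];\mathbb R^2)$ with its product inner product, write $y=(y_0,y_1)$ for $y\in H$, and put $$A_0=\begin{bmatrix}a_0&a_1\\0&a_0+a_1\end{bmatrix},\quad Gx=((\sigma x,0),0)\ (x\in\mathbb R),\quad Bx=(b_0x,\,b_1(\cdot)x)\ (x\in\mathbb R^2),\quad B^*y=b_0y_0+\int_{-d}^0b_1(\xi)y_1(\xi)\,d\xi .$$ For $\tau\ge0$ let $e^{\tau A}$ and $e^{\tau A^*}$ be the mutually adjoint $C_0$-semigroups on $H$ $$e^{\tau A}y=\Big(e^{\tau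 A_0}y_0+\int_{-d}^0\mathbf 1_{[-\tau,0]}(\xi)\,e^{(\tau+\xi)A_0}y_1(\xi)\,d\xi,\ \ y_1(\cdot-\tau)\mathbf 1_{[-d+\tau,0]}(\cdot)\Big),$$ $$e^{\tau A^*}y=\Big(e^{\tau A_0^*}y_0,\ \ e^{(\cdot+\tau)A_0^*}y_0\mathbf 1_{[-\tau,0]}(\cdot)+y_1(\cdot+\tau)\mathbf 1_{[-d,-\tau]}(\cdot)\Big).$$ For $t\in[0,T]$, $y\in H$ and $\tilde u=(u,z)\in\mathcal U\times\mathcal U$ let $Y^{t,y,\tilde u}$ be the mild solution on $[t,T]$ of $dY=(AY+B\tilde u)\,ds+G\,dW$, $Y(t)=y$, that is, the progressively measurable, pathwise continuous process in $L^2(\Omega\times[t,T];H)$ with $$Y(s)=e^{(s-t)A}y+\int_t^se^{(s-\rho)A}B\tilde u(\rho)\,d\rho+\int_t^se^{(s-\rho)A}G\,dW(\rho),\qquad s\in[t,T].$$ With $f((x,m),(u,z))=\alpha_0x-\alpha_1m-\beta_0u-\gamma_0u^2-\beta_1z-\gamma_1z^2$ and $g((x,m))=\lambda_0x-\lambda_1m$,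 put $$\mathcal J(t,y;\tilde u)=\mathbb E\Big[\int_t^Te^{-r(s-t)}f\big(Y^{t,y,\tilde u}_0(s),\tilde u(s)\big)\,ds+e^{-r(T-t)}g\big(Y^{t,y,\tilde u}_0(T)\big)\Big],$$ $$V(t,y)=\sup\{\mathcal J(t,y;\tilde u):\ \tilde u=(u,z)\in\mathcal U\times\mathcal U,\ u=z\}.$$ Let $\tilde\alpha=(\alpha_0,-\alpha_1)$, $\tilde\beta=(\beta_0,\beta_1)$, $\tilde\lambda=(\lambda_0,-\lambda_1)$, and for $q\in\mathbb R^2$ let $u^*(q)=\dfrac{\langle q-\tilde\beta,(1,1)\rangle}{2(\gamma_0+\gamma_1)}$, the maximiser over $u\in\mathbb R$ of $\langle q-\tilde\beta,(1,1)\rangle u-(\gamma_0+\gamma_1)u^2$. For $t\in[0,T]$ and $y\in H$ define $$a(t)=e^{-r(T-t)}e^{(T-t)A^*}(\tilde\lambda,0)+\int_t^Te^{-r(s-t)}e^{(s-t)A^*}(\tilde\alpha,0)\,ds,$$ $$b(t)=\int_t^Te^{-r(s-t)}\,\frac{\langle B^*a(s)-\tilde\beta,(1,1)\rangle^2}{4(\gamma_0+\gamma_1)}\,ds,\qquad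 v(t,y)=\langle a(t),y\rangle+b(t).$$ **Theorem.** For all $t\in[0,T]$, $y\in H$ and $\tilde u\in\mathcal U\times\mathcal U$ the mild solution $Y^{t,y,\tilde u}$ exists and $\mathcal J(t,y;\tilde u)$ is well defined (the running and the final reward are integrable). Moreover: 1. For all $(t,y)\in[0,T]\times H$ we have $v(t,y)\ge V(t,y)$. 2. Let $t\in[0,T]$, $y\in H$, and let $\tilde u^*(s)=\big(u^*(B^*a(s)),u^*(B^*a(s))\big)$, $s\in[t,T]$ (a deterministic control). Then $\tilde u^*$ is admissible and optimal for $V(t,y)$, and $V(t,y)=v(t,y)=\mathcal J(t,y;\tilde u^*)$. -/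

import Mathlib

open MeasureTheory ProbabilityTheory Filter Topology Set
open scoped NNReal ENNReal

noncomputable section

namespace AdvertisingLQ

/-! ### The state space -/

/-- The plane `ℝ²` with its Euclidean inner product. -/
abbrev R2 : Type := EuclideanSpace ℝ (Fin 2)

/-- Lebesgue measure on the delay interval `[-d, 0]`. -/
abbrev delayMeasure (d : ℝ) : Measure ℝ := volume.restrict (Icc (-d) 0)

/-- The Hilbert space `H = ℝ² × L²([-d,0]; ℝ²)` with the inner product
`⟨y, y'⟩ = ⟨y₀, y'₀⟩ + ∫_{-d}^0 ⟨y₁(ξ), y'₁(ξ)⟩ dξ`. -/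
abbrev State (d : ℝ) : Type := WithLp 2 (R2 × Lp R2 2 (delayMeasure d))

/-- The element `(y₀, 0)` of `H`. -/
def inState (d : ℝ) (x : R2) : State d := WithLp.toLp 2 (x, 0)

/-- Extension by zero to the real line of (a representative of) an element of `L²([-d,0]; ℝ²)`. -/
def zeroExt {d : ℝ} (f : Lp R2 2 (delayMeasure d)) : ℝ → R2 :=
  (Icc (-d) 0).indicator f

theorem memLp_zeroExt {d : ℝ} (f : Lp R2 2 (delayMeasure d)) : MemLp (zeroExt f) 2 volume :=
  (memLp_indicator_iff_restrict measurableSet_Icc).2 (Lp.memLp f)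

theorem memLp_zeroExt_add {d : ℝ} (f : Lp R2 2 (delayMeasure d)) (c : ℝ) :
    MemLp (fun ξ => zeroExt f (ξ + c)) 2 (delayMeasure d) :=
  ((memLp_zeroExt f).comp_measurePreserving (measurePreserving_add_right volume c)).restrict _

theorem memLp_zeroExt_sub {d : ℝ} (f : Lp R2 2 (delayMeasure d)) (c : ℝ) :
    MemLp (fun ξ => zeroExt f (ξ - c)) 2 (delayMeasure d) :=
  ((memLp_zeroExt f).comp_measurePreserving (measurePreserving_sub_right volume c)).restrict _

/-! ### The data of the problem -/

/-- The coefficients of the linear-quadratic problem: horizon `T`, delay `d`, discount rate `r`,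
coefficients `a₀, a₁, b₀, b₁(·), σ` of the state equation, and coefficients of
the running and of the final reward. -/
structure Model where
  T : ℝ≥0
  d : ℝ
  r : ℝ
  a₀ : ℝ
  a₁ : ℝ
  b₀ : ℝ
  b₁ : Lp ℝ 2 (delayMeasure d)
  σ : ℝ
  α₀ : ℝ
  α₁ : ℝ
  β₀ : ℝ
  β₁ : ℝ
  γ₀ : ℝ
  γ₁ : ℝ
  lam₀ : ℝ
  lam₁ : ℝ

namespace Model

variable (M : Model)

/-- The state space of the model. -/
abbrev H : Type := State M.d

/-- The operator `A₀` on `ℝ²` with matrix `[[a₀, a₁], [0, a₀ + a₁]]`. -/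
def A₀ : R2 →L[ℝ] R2 :=
  Matrix.toEuclideanCLM (n := Fin 2) (𝕜 := ℝ) !![M.a₀, M.a₁; 0, M.a₀ + M.a₁]

/-- `e^{τ A₀}`. -/
def expA₀ (τ : ℝ) : R2 →L[ℝ] R2 := NormedSpace.exp (τ • M.A₀)

/-- `e^{τ A₀*}`. -/
def expA₀Adj (τ : ℝ) : R2 →L[ℝ] R2 :=
  NormedSpace.exp (τ • ContinuousLinearMap.adjoint M.A₀)

theorem continuous_expA₀Adj : Continuous M.expA₀Adj := by
  unfold expA₀Adj
  let : NormedAlgebra ℚ (R2 →L[ℝ] R2) := NormedAlgebra.restrictScalars ℚ ℝ _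
  exact (NormedSpace.exp_continuous (𝔸 := R2 →L[ℝ] R2)).comp (by fun_prop)

/-- The semigroup `e^{τ A}` on `H`, `τ ≥ 0`:
`e^{τA} y = (e^{τA₀} y₀ + ∫_{-d}^0 1_{[-τ,0]}(ξ) e^{(τ+ξ)A₀} y₁(ξ) dξ, y₁(· - τ) 1_{[-d+τ,0]})`.
For `τ ≥ 0` and `ξ ∈ [-d,0]` one has `ξ - τ ∈ [-d,0]` iff `ξ ∈ [-d+τ,0]`, so that the second
component is the translate of the extension of `y₁` by zero. -/
def semigroup (τ : ℝ) (y : M.H) : M.H :=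
  WithLp.toLp 2
    (M.expA₀ τ y.fst
        + ∫ ξ, (Icc (-τ) 0).indicator (fun ξ => M.expA₀ (τ + ξ) (y.snd ξ)) ξ ∂(delayMeasure M.d),
      (memLp_zeroExt_sub y.snd τ).toLp (fun ξ => zeroExt y.snd (ξ - τ)))

theorem memLp_adjTail (τ : ℝ) (x : R2) :
    MemLp ((Icc (-τ) 0).indicator (fun ξ => M.expA₀Adj (ξ + τ) x)) 2 (delayMeasure M.d) := by
  have hc : Continuous fun ξ : ℝ => M.expA₀Adj (ξ + τ) x :=
    (M.continuous_expA₀Adj.comp (by fun_prop)).clm_apply continuous_const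
  refine MemLp.indicator measurableSet_Icc ?_
  obtain ⟨C, hC⟩ := (isCompact_Icc (a := -M.d) (b := (0 : ℝ))).exists_bound_of_continuousOn
    hc.continuousOn
  exact MemLp.of_bound hc.aestronglyMeasurable C
    ((ae_restrict_iff' measurableSet_Icc).2 (Eventually.of_forall hC))

/-- The adjoint semigroup `e^{τ A*}` on `H`, `τ ≥ 0`:
`e^{τA*} y = (e^{τA₀*} y₀, e^{(· + τ)A₀*} y₀ 1_{[-τ,0]} + y₁(· + τ) 1_{[-d,-τ]})`.
For `τ ≥ 0` and `ξ ∈ [-d,0]` one has `ξ + τ ∈ [-d,0]` iff `ξ ∈ [-d,-τ]`. -/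
def semigroupAdj (τ : ℝ) (y : M.H) : M.H :=
  WithLp.toLp 2
    (M.expA₀Adj τ y.fst,
      (M.memLp_adjTail τ y.fst).toLp ((Icc (-τ) 0).indicator (fun ξ => M.expA₀Adj (ξ + τ) y.fst))
        + (memLp_zeroExt_add y.snd τ).toLp (fun ξ => zeroExt y.snd (ξ + τ)))

/-- The control operator `B x = (b₀ x, b₁(·) x)`. -/
def B (x : R2) : M.H :=
  WithLp.toLp 2 (M.b₀ • x, (ContinuousLinearMap.toSpanSingleton ℝ x).compLp M.b₁)

/-- The adjoint `B* y = b₀ y₀ + ∫_{-d}^0 b₁(ξ) y₁(ξ) dξ` of the control operator. -/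
def Badj (y : M.H) : R2 :=
  M.b₀ • y.fst + ∫ ξ, M.b₁ ξ • y.snd ξ ∂(delayMeasure M.d)

/-- The noise operator `G x = ((σ x, 0), 0)`. -/
def G (x : ℝ) : M.H := inState M.d !₂[M.σ * x, 0]

/-- Running reward, on `(x, m)` and `(u, z)`:
`f = α₀ x - α₁ m - β₀ u - γ₀ u² - β₁ z - γ₁ z²`. -/
def f (x w : R2) : ℝ :=
  M.α₀ * x 0 - M.α₁ * x 1 - M.β₀ * w 0 - M.γ₀ * w 0 ^ 2 - M.β₁ * w 1 - M.γ₁ * w 1 ^ 2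

/-- Final reward `g(x, m) = λ₀ x - λ₁ m`. -/
def g (x : R2) : ℝ := M.lam₀ * x 0 - M.lam₁ * x 1

/-- `α̃ = (α₀, -α₁)`. -/
def αt : R2 := !₂[M.α₀, -M.α₁]

/-- `β̃ = (β₀, β₁)`. -/
def βt : R2 := !₂[M.β₀, M.β₁]

/-- `λ̃ = (λ₀, -λ₁)`. -/
def lamt : R2 := !₂[M.lam₀, -M.lam₁]

/-! ### The candidate value function and the feedback -/

/-- `a(t) = e^{(T-t)(A*-r)} (λ̃,0) + ∫_t^T e^{(s-t)(A*-r)} (α̃,0) ds`. -/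
def a (t : ℝ) : M.H :=
  Real.exp (-M.r * (M.T - t)) • M.semigroupAdj (M.T - t) (inState M.d M.lamt)
    + ∫ s in t..(M.T : ℝ),
        Real.exp (-M.r * (s - t)) • M.semigroupAdj (s - t) (inState M.d M.αt)

/-- `b(t) = ∫_t^T e^{-r(s-t)} ⟨B* a(s) - β̃, (1,1)⟩² / (4 (γ₀ + γ₁)) ds`. -/
def b (t : ℝ) : ℝ :=
  ∫ s in t..(M.T : ℝ), Real.exp (-M.r * (s - t))
    * ((inner ℝ (M.Badj (M.a s) - M.βt) (!₂[1, 1] : R2)) ^ 2 / (4 * (M.γ₀ + M.γ₁)))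

/-- `v(t, y) = ⟨a(t), y⟩ + b(t)`. -/
def v (t : ℝ) (y : M.H) : ℝ := inner ℝ (M.a t) y + M.b t

/-- `u*(q) = ⟨q - β̃, (1,1)⟩ / (2 (γ₀ + γ₁))`. -/
def ustar (q : R2) : ℝ :=
  inner ℝ (q - M.βt) (!₂[1, 1] : R2) / (2 * (M.γ₀ + M.γ₁))

/-- `u*(q)` is the unique maximiser of
`u ↦ ⟨α̃, x⟩ + ⟨q - β̃, (1,1)⟩ u - (γ₀ + γ₁) u²` over `U = ℝ`. -/
theorem eq_ustar_iff_isMax (h₀ : 0 < M.γ₀) (h₁ : 0 < M.γ₁) (x q : R2) (u : ℝ) :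
    u = M.ustar q ↔ ∀ w : ℝ,
      inner ℝ M.αt x + inner ℝ (q - M.βt) (!₂[1, 1] : R2) * w - (M.γ₀ + M.γ₁) * w ^ 2
        ≤ inner ℝ M.αt x + inner ℝ (q - M.βt) (!₂[1, 1] : R2) * u - (M.γ₀ + M.γ₁) * u ^ 2 := by
  unfold ustar
  generalize inner ℝ M.αt x = c
  generalize inner ℝ (q - M.βt) (!₂[1, 1] : R2) = p
  have hγ : 0 < M.γ₀ + M.γ₁ := add_pos h₀ h₁
  generalize M.γ₀ + M.γ₁ = γ at hγ
  have key : ∀ w : ℝ, c + p * w - γ * w ^ 2 = c + p ^ 2 / (4 * γ) - γ * (w - p / (2 * γ)) ^ 2 := by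
    intro w
    field_simp
    ring
  constructor
  · rintro rfl w
    rw [key w, key (p / (2 * γ))]
    have : 0 ≤ γ * (w - p / (2 * γ)) ^ 2 := by positivity
    simp only [sub_self]
    linarith
  · intro h
    have h' := h (p / (2 * γ))
    rw [key u, key (p / (2 * γ))] at h'
    have h2 : (u - p / (2 * γ)) ^ 2 ≤ 0 := by
      simp only [sub_self] at h'
      nlinarith
    have h3 := pow_eq_zero_iff (two_ne_zero) |>.1 (le_antisymm h2 (sq_nonneg _))
    linarith

end Model

/-! ### Brownian filtration and Wiener integrals of deterministic integrands -/

section Probability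

variable {Ω : Type*} [MeasurableSpace Ω]

/-- The augmentation of the filtration generated by the Brownian motion `W`:
`F_t` is generated by the `W_s`, `s ≤ t`, and by all `P`-null sets. -/
def brownianFiltration (P : Measure Ω) [P.IsComplete] (W : ℝ≥0 → Ω → ℝ)
    (hW : IsBrownianReal W P) : Filtration ℝ≥0 (inferInstance : MeasurableSpace Ω) where
  seq t := (⨆ s ≤ t, MeasurableSpace.comap (W s) inferInstance)
    ⊔ MeasurableSpace.generateFrom {N : Set Ω | P N = 0}
  mono' _ _ hij :=
    sup_le_sup_right (biSup_mono fun _ hs => le_trans hs hij) _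
  le' _ := sup_le
    (iSup₂_le fun s _ =>
      (NullMeasurable.measurable_of_complete (hW.aemeasurable s).nullMeasurable).comap_le)
    (MeasurableSpace.generateFrom_le fun _ hN => measurableSet_of_null hN)

/-- A deterministic step function on `(t, s]`, constant equal to `val i` on
`(pt i, pt (i+1)]`, for a partition `t = pt 0 ≤ … ≤ pt n = s`. -/
structure StepData (E : Type*) (t s : ℝ≥0) where
  n : ℕ
  pt : ℕ → ℝ≥0
  mono : Monotone pt
  pt_zero : pt 0 = t
  pt_last : pt n = s
  val : ℕ → E

variable {E : Type*} [NormedAddCommGroup E] [NormedSpace ℝ E]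

/-- The step function as a function of time. -/
def StepData.toFun {t s : ℝ≥0} (φ : StepData E t s) (r : ℝ) : E :=
  ∑ i ∈ Finset.range φ.n, (Ioc (φ.pt i : ℝ) (φ.pt (i + 1) : ℝ)).indicator (fun _ => φ.val i) r

/-- The elementary integral `∑ᵢ (W(pt (i+1)) - W(pt i)) val i`. -/
def StepData.integral {t s : ℝ≥0} (φ : StepData E t s) (W : ℝ≥0 → Ω → ℝ) (ω : Ω) : E :=
  ∑ i ∈ Finset.range φ.n, (W (φ.pt (i + 1)) ω - W (φ.pt i) ω) • φ.val i

/-- `I` is (a version of) the stochastic integral `∫_t^s Φ(r) dW(r)` of the deterministic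
integrand `Φ ∈ L²([t,s]; E)`: the `L²(Ω)`-limit of the elementary integrals of step functions
converging to `Φ` in `L²([t,s]; E)`. -/
def IsWienerIntegral (P : Measure Ω) (W : ℝ≥0 → Ω → ℝ) (t s : ℝ≥0) (Φ : ℝ → E) (I : Ω → E) :
    Prop :=
  MemLp Φ 2 (volume.restrict (Ioc (t : ℝ) s)) ∧ MemLp I 2 P ∧
  ∃ φ : ℕ → StepData E t s,
    Tendsto (fun k => eLpNorm (fun r => Φ r - (φ k).toFun r) 2 (volume.restrict (Ioc (t : ℝ) s)))
      atTop (𝓝 0) ∧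
    Tendsto (fun k => eLpNorm (fun ω => I ω - (φ k).integral W ω) 2 P) atTop (𝓝 0)

/-! ### The control problem -/

namespace Model

variable (M : Model) (P : Measure Ω) [P.IsComplete] (W : ℝ≥0 → Ω → ℝ) (hW : IsBrownianReal W P)

/-- The set `𝒰` of admissible scalar controls: real-valued, progressively measurable processes in
`L²(Ω × [0,T])`; the values at times after `T` play no role. -/
def Admissible (u : ℝ≥0 → Ω → ℝ) : Prop :=
  IsStronglyProgressive (brownianFiltration P W hW) u ∧
  MemLp (fun p : ℝ × Ω => u p.1.toNNReal p.2) 2 ((volume.restrict (Icc 0 (M.T : ℝ))).prod P)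

/-- The `ℝ²`-valued control `ũ = (u, z)`. -/
def pair (u z : ℝ≥0 → Ω → ℝ) : ℝ≥0 → Ω → R2 := fun s ω => !₂[u s ω, z s ω]

/-- `Y` is a mild solution on `[t,T]` of `dY = (A Y + B ũ) ds + G dW`, `Y(t) = y`: a
progressively measurable, pathwise continuous process in `L²(Ω × [t,T]; H)` with
`Y(s) = e^{(s-t)A} y + ∫_t^s e^{(s-r)A} B ũ(r) dr + ∫_t^s e^{(s-r)A} G dW(r)` for `s ∈ [t,T]`.
Its values at times outside `[t,T]` play no role. -/
structure IsMildSolution (t : ℝ≥0) (y : M.H) (ut : ℝ≥0 → Ω → R2) (Y : ℝ≥0 → Ω → M.H) : Prop where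
  progressive : IsStronglyProgressive (brownianFiltration P W hW) Y
  continuous : ∀ᵐ ω ∂P, ContinuousOn (fun s => Y s ω) (Icc t M.T)
  memLp : MemLp (fun p : ℝ × Ω => Y p.1.toNNReal p.2) 2
    ((volume.restrict (Icc (t : ℝ) M.T)).prod P)
  formula : ∀ s ∈ Icc t M.T, ∃ I : Ω → M.H,
    IsWienerIntegral P W t s (fun r => M.semigroup (s - r) (M.G 1)) I ∧
    ∀ᵐ ω ∂P, Y s ω = M.semigroup (s - t) y
      + (∫ r in (t : ℝ)..s, M.semigroup (s - r) (M.B (ut r.toNNReal ω))) + I ω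

open Classical in
/-- The mild solution `Y^{t,y,ũ}`. -/
def mildSolution (t : ℝ≥0) (y : M.H) (ut : ℝ≥0 → Ω → R2) : ℝ≥0 → Ω → M.H :=
  if h : ∃ Y, M.IsMildSolution P W hW t y ut Y then h.choose else fun _ _ => 0

/-- The reward functional
`𝒥(t,y;ũ) = E[∫_t^T e^{-r(s-t)} f(Y₀(s), ũ(s)) ds + e^{-r(T-t)} g(Y₀(T))]`, `Y = Y^{t,y,ũ}`. -/
def J (t : ℝ≥0) (y : M.H) (ut : ℝ≥0 → Ω → R2) : ℝ :=
  ∫ ω, ((∫ s in (t : ℝ)..M.T, Real.exp (-M.r * (s - t))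
        * M.f (M.mildSolution P W hW t y ut s.toNNReal ω).fst (ut s.toNNReal ω))
      + Real.exp (-M.r * (M.T - t)) * M.g (M.mildSolution P W hW t y ut M.T ω).fst) ∂P

/-- The value function `V(t,y) = sup {𝒥(t,y;ũ) : ũ = (u,z) ∈ 𝒰 × 𝒰, u = z}`, a supremum of
extended reals. -/
def V (t : ℝ≥0) (y : M.H) : EReal :=
  sSup {x : EReal | ∃ u z : ℝ≥0 → Ω → ℝ, M.Admissible P W hW u ∧ M.Admissible P W hW z ∧ u = z ∧
    x = ((M.J P W hW t y (pair u z) : ℝ) : EReal)}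

/-- Well-posedness of the state equation and of the reward for the control `ũ`: the mild solution
exists (hence `mildSolution` is one), and the running and the final reward are integrable. -/
def WellPosed (t : ℝ≥0) (y : M.H) (ut : ℝ≥0 → Ω → R2) : Prop :=
  M.IsMildSolution P W hW t y ut (M.mildSolution P W hW t y ut) ∧
  Integrable (fun p : ℝ × Ω => Real.exp (-M.r * (p.1 - t))
      * M.f (M.mildSolution P W hW t y ut p.1.toNNReal p.2).fst (ut p.1.toNNReal p.2))
    ((volume.restrict (Icc (t : ℝ) M.T)).prod P) ∧
  Integrable (fun ω => M.g (M.mildSolution P W hW t y ut M.T ω).fst) P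

/-- The deterministic process `s ↦ u*(B* a(s))`, `s ∈ [t,T]`; as a process on `[0,∞)` it is
extended by zero outside `[t,T]`. -/
def uOpt (Ω : Type*) (t : ℝ≥0) : ℝ≥0 → Ω → ℝ :=
  fun s _ => (Icc t M.T).indicator (fun s => M.ustar (M.Badj (M.a s))) s

end Model

end Probability

end AdvertisingLQ

end

/-!
The problem is linear in the state, so no dynamic programming or Itô formula is needed: the reward
can be computed in closed form.

*Mild solutions.* The noise `G` acts on the present `ℝ²` only, where the semigroup is the matrix
exponential, so the stochastic convolution has a continuously differentiable deterministic integrand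
and partial integration expresses it through the Brownian path
(`isWienerIntegral_byParts`): `∫_t^s Φ dW = (W_s - W_t) Φ(s) - ∫_t^s (W_r - W_t) Φ'(r) dr`.
The drift and this last integral are both causal convolutions `∫_t^s v(r) k(s - r) dr` of an
admissible process `v` with a continuous kernel `k`; these have continuous, adapted, square
integrable versions (`Model.Admissible.exists_conv`), which gives existence
(`Model.exists_isMildSolution`). The kernels are continuous because the delay semigroup is strongly
continuous (`Model.continuous_semigroup`), a consequence of the continuity of translations in `L²`.

*The reward.* Wiener integrals have mean zero (`IsWienerIntegral.integral_eq_zero`), so the mean of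
any mild solution solves the deterministic equation driven by the mean of the control. Duality,
`⟨e^{τA*}(x,0), y⟩ = ⟨x, (e^{τA} y)₀⟩` and `⟨h, B w⟩ = ⟨B* h, w⟩`, moves the semigroups onto
`(α̃,0)` and `(λ̃,0)`, and exchanging the order of integration over the triangle collects them in
the adjoint state `a` (`Model.linear_reward_eq`). For a control `(u, u)` this gives (`Model.J_eq`)
`𝒥 = ⟨a(t), y⟩ + ∫_t^T e^{-r(q-t)} (c(q) E[u_q] - (γ₀ + γ₁) E[u_q²]) dq`
with `c(q) = ⟨B* a(q) - β̃, (1,1)⟩`.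

*Optimality.* Since `E[u_q]² ≤ E[u_q²]`, completing the square bounds the integrand by
`e^{-r(q-t)} c(q)² / (4 (γ₀ + γ₁))`, the integrand of `b` (`Model.J_le_v`), with equality for the
deterministic control `u_q = c(q) / (2 (γ₀ + γ₁)) = u*(B* a(q))` (`Model.J_uOpt`).
-/

namespace AdvertisingLQ

/-! ### Integrals depending on a parameter -/

section Analysis

variable {E : Type*} [NormedAddCommGroup E]

/-- Pointwise almost everywhere continuity and local boundedness of a family of functions on a
finite measure space give continuity in `L²`. -/
theorem continuous_toLp_of_bounded {α : Type*} [MeasurableSpace α] {μ : Measure α}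
    [IsFiniteMeasure μ] {f : ℝ → α → E} (hf : ∀ τ, MemLp (f τ) 2 μ)
    (hb : ∀ τ₀, ∃ C, ∀ᶠ τ in 𝓝 τ₀, ∀ᵐ ξ ∂μ, ‖f τ ξ‖ ≤ C)
    (hc : ∀ τ₀, ∀ᵐ ξ ∂μ, ContinuousAt (fun τ => f τ ξ) τ₀) :
    Continuous fun τ => (hf τ).toLp (f τ) := by
  refine continuous_iff_continuousAt.2 fun τ₀ => ?_
  rw [ContinuousAt, tendsto_iff_edist_tendsto_0]
  simp_rw [Lp.edist_toLp_toLp,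
    eLpNorm_eq_lintegral_rpow_enorm_toReal two_ne_zero ENNReal.ofNat_ne_top]
  obtain ⟨C, hC⟩ := hb τ₀
  have hC0 : ∀ᵐ ξ ∂μ, ‖f τ₀ ξ‖ ≤ C := hC.self_of_nhds
  have key : Tendsto (fun τ => ∫⁻ ξ, ‖(f τ - f τ₀) ξ‖ₑ ^ (ENNReal.toReal 2) ∂μ) (𝓝 τ₀)
      (𝓝 (∫⁻ _, 0 ∂μ)) := by
    refine tendsto_of_seq_tendsto fun x hx => ?_
    obtain ⟨n₀, hn₀⟩ := eventually_atTop.1 (hx.eventually hC)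
    refine (tendsto_add_atTop_iff_nat n₀).1 ?_
    have hx' := (tendsto_add_atTop_iff_nat n₀).2 hx
    refine tendsto_lintegral_of_dominated_convergence'
      (fun _ => ENNReal.ofReal (C + C) ^ (ENNReal.toReal 2)) ?_ ?_ ?_ ?_
    · exact fun n => (((hf _).1.sub (hf τ₀).1).enorm.pow_const _)
    · intro n
      filter_upwards [hn₀ (n + n₀) (Nat.le_add_left _ _), hC0] with ξ h1 h2
      gcongr
      rw [← ofReal_norm]
      exact ENNReal.ofReal_le_ofReal ((norm_sub_le _ _).trans (add_le_add h1 h2))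
    · simp only [lintegral_const]
      exact ENNReal.mul_ne_top (by simp) (measure_ne_top _ _)
    · filter_upwards [hc τ₀] with ξ hξ
      have h1 : Tendsto (fun τ => ‖f τ ξ - f τ₀ ξ‖ₑ) (𝓝 τ₀) (𝓝 0) := by
        have := tendsto_iff_edist_tendsto_0.1 hξ
        simpa only [edist_eq_enorm_sub] using this
      have h2 := ((ENNReal.continuous_rpow_const (y := ENNReal.toReal 2)).tendsto 0 |>.comp h1).comp
        hx'
      simpa [Function.comp_def] using h2
  have h3 := (ENNReal.continuous_rpow_const (y := 1 / ENNReal.toReal 2)).tendsto _ |>.comp key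
  simpa [Function.comp_def] using h3

/-- Translation is continuous in `L²`, also after restriction to the delay interval. -/
theorem continuous_toLp_zeroExt_sub {d : ℝ} (f : Lp R2 2 (delayMeasure d)) :
    Continuous fun τ => (memLp_zeroExt_sub f τ).toLp (fun ξ => zeroExt f (ξ - τ)) := by
  have h : Continuous fun τ : ℝ =>
      DomAddAct.mk (-τ) +ᵥ (memLp_zeroExt f).toLp (zeroExt f) := by
    have : Fact ((2 : ℝ≥0∞) ≠ ∞) := ⟨by simp⟩
    have h0 : Continuous fun τ : ℝ => DomAddAct.mk (-τ) :=
      DomAddAct.continuous_mk.comp continuous_neg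
    exact h0.vadd continuous_const
  have hmem : ∀ τ : ℝ, MemLp (fun ξ => zeroExt f (ξ - τ)) 2 volume := fun τ =>
    (memLp_zeroExt f).comp_measurePreserving (measurePreserving_sub_right volume τ)
  have heq : ∀ τ : ℝ, DomAddAct.mk (-τ) +ᵥ (memLp_zeroExt f).toLp (zeroExt f)
      = (hmem τ).toLp (fun ξ => zeroExt f (ξ - τ)) := by
    intro τ
    rw [DomAddAct.mk_vadd_toLp]
    congr 1
    ext ξ
    simp [sub_eq_neg_add]
  simp_rw [heq] at h
  rw [continuous_iff_continuousAt] at h ⊢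
  intro τ₀
  have h1 := tendsto_iff_edist_tendsto_0.1 (h τ₀)
  refine tendsto_iff_edist_tendsto_0.2 (tendsto_of_tendsto_of_tendsto_of_le_of_le
    tendsto_const_nhds h1 (fun _ => zero_le) fun τ => ?_)
  simp only [Lp.edist_toLp_toLp]
  exact eLpNorm_mono_measure _ Measure.restrict_le_self

/-- A crude form of Minkowski's integral inequality over a finite measure space. -/
theorem eLpNorm_integral_norm_le {α Ω : Type*} [MeasurableSpace α] [MeasurableSpace Ω]
    {μ : Measure α} [IsFiniteMeasure μ] {P : Measure Ω} [SFinite P] {F : α × Ω → E}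
    (hF : AEStronglyMeasurable F (μ.prod P)) :
    eLpNorm (fun ω => ∫ r, ‖F (r, ω)‖ ∂μ) 2 P
      ≤ μ univ ^ (1 / 2 : ℝ) * eLpNorm F 2 (μ.prod P) := by
  have hF' := hF.prod_swap
  have hsec : ∀ᵐ ω ∂P, AEStronglyMeasurable (fun r => F (r, ω)) μ := hF'.prodMk_left
  have h1 : ∀ᵐ ω ∂P, ‖∫ r, ‖F (r, ω)‖ ∂μ‖ₑ ^ (2 : ℝ)
      ≤ μ univ * ∫⁻ r, ‖F (r, ω)‖ₑ ^ (2 : ℝ) ∂μ := by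
    filter_upwards [hsec] with ω hω
    have h2 : ‖∫ r, ‖F (r, ω)‖ ∂μ‖ₑ ≤ ∫⁻ r, ‖F (r, ω)‖ₑ ∂μ := by
      simpa using enorm_integral_le_lintegral_enorm (μ := μ) (fun r => ‖F (r, ω)‖)
    have h3 := eLpNorm_le_eLpNorm_mul_rpow_measure_univ (p := 1) (q := 2) (by norm_num) hω
    rw [eLpNorm_one_eq_lintegral_enorm,
      eLpNorm_eq_lintegral_rpow_enorm_toReal two_ne_zero ENNReal.ofNat_ne_top] at h3
    calc ‖∫ r, ‖F (r, ω)‖ ∂μ‖ₑ ^ (2 : ℝ)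
        ≤ _ := ENNReal.rpow_le_rpow (h2.trans h3) (by norm_num)
      _ = _ := by
        rw [ENNReal.mul_rpow_of_nonneg _ _ (by norm_num), ← ENNReal.rpow_mul, ← ENNReal.rpow_mul]
        norm_num [mul_comm]
  rw [eLpNorm_eq_lintegral_rpow_enorm_toReal two_ne_zero ENNReal.ofNat_ne_top,
    eLpNorm_eq_lintegral_rpow_enorm_toReal two_ne_zero ENNReal.ofNat_ne_top]
  simp only [ENNReal.toReal_ofNat]
  rw [← ENNReal.mul_rpow_of_nonneg _ _ (by norm_num)]
  refine ENNReal.rpow_le_rpow ?_ (by norm_num)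
  calc _ ≤ ∫⁻ ω, μ univ * ∫⁻ r, ‖F (r, ω)‖ₑ ^ (2 : ℝ) ∂μ ∂P := lintegral_mono_ae h1
    _ = μ univ * ∫⁻ ω, ∫⁻ r, ‖F (r, ω)‖ₑ ^ (2 : ℝ) ∂μ ∂P :=
      lintegral_const_mul' _ _ (measure_ne_top _ _)
    _ = _ := by rw [lintegral_prod_symm _ (hF.enorm.pow_const _)]

theorem memLp_integral_norm {α Ω : Type*} [MeasurableSpace α] [MeasurableSpace Ω]
    {μ : Measure α} [IsFiniteMeasure μ] {P : Measure Ω} [SFinite P] {F : α × Ω → E}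
    (hF : MemLp F 2 (μ.prod P)) : MemLp (fun ω => ∫ r, ‖F (r, ω)‖ ∂μ) 2 P :=
  ⟨hF.1.norm.prod_swap.integral_prod_right',
    (eLpNorm_integral_norm_le hF.1).trans_lt
      (ENNReal.mul_lt_top (ENNReal.rpow_lt_top_of_nonneg (by norm_num) (measure_ne_top _ _)) hF.2)⟩

variable [NormedSpace ℝ E]

/-- The causal convolution `∫_t^{min s T} v(r) k(s - r) dr`. For `s ∈ [t, T]` it is
`∫_t^s v(r) k(s - r) dr`; writing it over the fixed interval `(t, T]` makes it continuous in
`s ∈ ℝ`. -/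
noncomputable def conv (t T : ℝ) (v : ℝ → ℝ) (k : ℝ → E) (s : ℝ) : E :=
  ∫ r in Ioc t T, (Iic s).indicator (fun r => v r • k (s - r)) r

theorem conv_eq_intervalIntegral {t T s : ℝ} (hs : s ∈ Icc t T) (v : ℝ → ℝ) (k : ℝ → E) :
    conv t T v k s = ∫ r in t..s, v r • k (s - r) := by
  rw [conv, setIntegral_indicator measurableSet_Iic, intervalIntegral.integral_of_le hs.1,
    Ioc_inter_Iic, min_eq_right hs.2]

theorem continuous_conv {t T : ℝ} {v : ℝ → ℝ} {k : ℝ → E} (hv : IntegrableOn v (Ioc t T))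
    (hk : Continuous k) : Continuous (conv t T v k) := by
  refine continuous_iff_continuousAt.2 fun s₀ => ?_
  obtain ⟨C, hC⟩ := (isCompact_Icc (a := s₀ - 1 - T) (b := s₀ + 1 - t)).exists_bound_of_continuousOn
    hk.continuousOn
  refine continuousAt_of_dominated (bound := fun r => C * ‖v r‖) ?_ ?_ ?_ ?_
  · exact .of_forall fun s => (hv.aestronglyMeasurable.smul
      (hk.comp (by fun_prop)).aestronglyMeasurable).indicator measurableSet_Iic
  · filter_upwards [Icc_mem_nhds (by linarith : s₀ - 1 < s₀) (by linarith : s₀ < s₀ + 1)] with s hs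
    filter_upwards [ae_restrict_mem measurableSet_Ioc] with r hr
    refine (norm_indicator_le_norm_self _ _).trans ?_
    rw [norm_smul, mul_comm]
    exact mul_le_mul_of_nonneg_right (hC _ ⟨by linarith [hs.1, hr.2], by linarith [hs.2, hr.1]⟩)
      (norm_nonneg _)
  · exact hv.norm.const_mul C
  · have h0 : ∀ᵐ r ∂(volume.restrict (Ioc t T)), r ≠ s₀ := by
      refine ae_restrict_of_ae ?_
      simp [ae_iff]
    filter_upwards [h0] with r hr
    have h1 : ContinuousAt (fun s => v r • k (s - r)) s₀ := by fun_prop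
    rcases lt_or_gt_of_ne hr with h | h
    · refine h1.congr ?_
      filter_upwards [Ioi_mem_nhds h] with s hs
      rw [indicator_of_mem (mem_Iic.2 (le_of_lt hs))]
    · refine (continuousAt_const (y := (0 : E))).congr ?_
      filter_upwards [Iio_mem_nhds h] with s hs
      rw [indicator_of_notMem]
      simpa using hs

theorem norm_conv_le {t T s C : ℝ} {v : ℝ → ℝ} {k : ℝ → E} (hv : IntegrableOn v (Ioc t T))
    (hs : s ∈ Icc t T) (hC : ∀ τ ∈ Icc 0 (T - t), ‖k τ‖ ≤ C) :
    ‖conv t T v k s‖ ≤ C * ∫ r in Ioc t T, ‖v r‖ := by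
  rw [← integral_const_mul]
  refine norm_integral_le_of_norm_le (hv.norm.const_mul C) ?_
  filter_upwards [ae_restrict_mem measurableSet_Ioc] with r hr
  by_cases h : r ≤ s
  · rw [indicator_of_mem (mem_Iic.2 h), norm_smul, mul_comm]
    exact mul_le_mul_of_nonneg_right (hC _ ⟨by linarith, by linarith [hs.2, hr.1]⟩) (norm_nonneg _)
  · rw [indicator_of_notMem (by simpa using h), norm_zero]
    have : 0 ≤ C := (norm_nonneg _).trans (hC 0 ⟨le_rfl, by linarith [hs.1, hs.2]⟩)
    positivity

/-- The convolution of a process with a kernel depends, at time `s`, on the values of the process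
up to time `s` only. -/
theorem stronglyMeasurable_conv {Ω : Type*} {m : MeasurableSpace Ω} {U : ℝ≥0 → Ω → ℝ} {s : ℝ≥0}
    (hU : StronglyMeasurable fun p : Iic s × Ω => U p.1 p.2) {k : ℝ → E} (hk : Continuous k)
    (t T : ℝ) :
    StronglyMeasurable fun ω => conv t T (fun r => U r.toNNReal ω) k s := by
  have h1 : StronglyMeasurable fun p : Ω × ℝ => U (min p.2.toNNReal s) p.1 := by
    have hm : Measurable fun p : Ω × ℝ =>
        ((⟨min p.2.toNNReal s, mem_Iic.2 (min_le_right _ _)⟩, p.1) : Iic s × Ω) :=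
      ((measurable_snd.real_toNNReal.min measurable_const).subtype_mk).prodMk measurable_fst
    exact hU.comp_measurable hm
  have h2 : StronglyMeasurable fun p : Ω × ℝ =>
      {p : Ω × ℝ | p.2 ≤ s}.indicator
        (fun p => U (min p.2.toNNReal s) p.1 • k (s - p.2)) p := by
    refine (h1.smul ?_).indicator (measurableSet_le measurable_snd measurable_const)
    exact hk.stronglyMeasurable.comp_measurable (measurable_const.sub measurable_snd)
  have h3 := h2.integral_prod_right' (ν := volume.restrict (Ioc t T))
  convert h3 using 2 with ω
  refine integral_congr_ae (.of_forall fun r => ?_)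
  by_cases h : r ≤ s
  · have : min r.toNNReal s = r.toNNReal := min_eq_left (by
      rw [Real.toNNReal_le_iff_le_coe]; exact h)
    simp [h, this]
  · simp [h]

end Analysis

/-! ### The delay semigroup and its adjoint -/

section Semigroup

theorem integrable_snd {d : ℝ} (f : Lp R2 2 (delayMeasure d)) : Integrable f (delayMeasure d) :=
  (Lp.memLp f).integrable (by norm_num)

namespace Model

variable (M : Model)

theorem continuous_expA₀ : Continuous M.expA₀ := by
  unfold expA₀
  let : NormedAlgebra ℚ (R2 →L[ℝ] R2) := NormedAlgebra.restrictScalars ℚ ℝ _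
  exact (NormedSpace.exp_continuous (𝔸 := R2 →L[ℝ] R2)).comp (by fun_prop)

theorem hasDerivAt_expA₀ (τ : ℝ) : HasDerivAt M.expA₀ (M.expA₀ τ * M.A₀) τ :=
  hasDerivAt_exp_smul_const M.A₀ τ

theorem adjoint_expA₀ (τ : ℝ) : ContinuousLinearMap.adjoint (M.expA₀ τ) = M.expA₀Adj τ := by
  unfold expA₀ expA₀Adj
  rw [← ContinuousLinearMap.star_eq_adjoint, ← ContinuousLinearMap.star_eq_adjoint,
    NormedSpace.star_exp, star_smul, star_trivial]

theorem exists_norm_expA₀_le (a b : ℝ) : ∃ C, ∀ τ ∈ Icc a b, ‖M.expA₀ τ‖ ≤ C :=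
  isCompact_Icc.exists_bound_of_continuousOn M.continuous_expA₀.continuousOn

theorem exists_norm_expA₀Adj_apply_le (x : R2) (a b : ℝ) :
    ∃ C, ∀ τ ∈ Icc a b, ‖M.expA₀Adj τ x‖ ≤ C :=
  isCompact_Icc.exists_bound_of_continuousOn
    (M.continuous_expA₀Adj.clm_apply (continuous_const (y := x))).continuousOn

/-- At a given `τ₀` the cut-off `1_{[-τ,0]}(ξ)` is continuous in `τ` for every `ξ` but `-τ₀`. -/
theorem ae_continuousAt_indicator_delay {E : Type*} [NormedAddCommGroup E] {d : ℝ}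
    {h : ℝ → ℝ → E} (hh : ∀ ξ, Continuous fun τ => h τ ξ) (τ₀ : ℝ) :
    ∀ᵐ ξ ∂(delayMeasure d), ContinuousAt (fun τ => (Icc (-τ) 0).indicator (h τ) ξ) τ₀ := by
  have h0 : ∀ᵐ ξ ∂(delayMeasure d), ξ ≠ -τ₀ :=
    ae_restrict_of_ae (by simp [ae_iff])
  filter_upwards [h0] with ξ hξ
  by_cases hξ0 : ξ ≤ 0
  · rcases lt_or_gt_of_ne hξ with h | h
    · refine (continuousAt_const (y := (0 : E))).congr ?_
      filter_upwards [Iio_mem_nhds (show τ₀ < -ξ by linarith)] with τ hτ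
      rw [indicator_of_notMem]
      rintro ⟨h1, -⟩
      linarith [mem_Iio.1 hτ]
    · refine (hh ξ).continuousAt.congr ?_
      filter_upwards [Ioi_mem_nhds (show -ξ < τ₀ by linarith)] with τ hτ
      rw [indicator_of_mem]
      exact ⟨by linarith [mem_Ioi.1 hτ], hξ0⟩
  · refine (continuousAt_const (y := (0 : E))).congr (.of_forall fun τ => ?_)
    exact (indicator_of_notMem (fun h1 => hξ0 h1.2) _).symm

theorem aestronglyMeasurable_expA₀_snd (τ : ℝ) (f : Lp R2 2 (delayMeasure M.d)) :
    AEStronglyMeasurable (fun ξ => M.expA₀ (τ + ξ) (f ξ)) (delayMeasure M.d) := by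
  have h := (M.continuous_expA₀.comp (continuous_const_add τ)).aestronglyMeasurable
    (μ := delayMeasure M.d)
  exact (ContinuousLinearMap.id ℝ (R2 →L[ℝ] R2)).flip.aestronglyMeasurable_comp₂
    (Lp.aestronglyMeasurable f) h

theorem integrable_expA₀_snd (τ : ℝ) (f : Lp R2 2 (delayMeasure M.d)) :
    Integrable ((Icc (-τ) 0).indicator fun ξ => M.expA₀ (τ + ξ) (f ξ)) (delayMeasure M.d) := by
  obtain ⟨C, hC⟩ := M.exists_norm_expA₀_le (τ - M.d) τ
  refine Integrable.indicator ?_ measurableSet_Icc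
  refine ((integrable_snd f).norm.const_mul C).mono' (M.aestronglyMeasurable_expA₀_snd τ f) ?_
  filter_upwards [ae_restrict_mem measurableSet_Icc] with ξ hξ
  exact (ContinuousLinearMap.le_opNorm _ _).trans (mul_le_mul_of_nonneg_right
    (hC _ ⟨by linarith [hξ.1], by linarith [hξ.2]⟩) (norm_nonneg _))

theorem continuous_semigroup (y : M.H) : Continuous fun τ => M.semigroup τ y := by
  refine (WithLp.prod_continuous_toLp 2 _ _).comp (Continuous.prodMk ?_ ?_)
  · refine Continuous.add (M.continuous_expA₀.clm_apply continuous_const) ?_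
    refine continuous_iff_continuousAt.2 fun τ₀ => ?_
    obtain ⟨C, hC⟩ := M.exists_norm_expA₀_le (τ₀ - 1 - M.d) (τ₀ + 1)
    refine continuousAt_of_dominated (bound := fun ξ => C * ‖y.snd ξ‖) ?_ ?_
      ((integrable_snd y.snd).norm.const_mul C) ?_
    · exact .of_forall fun τ => (M.integrable_expA₀_snd τ y.snd).1
    · filter_upwards [Icc_mem_nhds (by linarith : τ₀ - 1 < τ₀) (by linarith : τ₀ < τ₀ + 1)]
        with τ hτ
      filter_upwards [ae_restrict_mem measurableSet_Icc] with ξ hξ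
      refine (norm_indicator_le_norm_self _ _).trans ?_
      exact (ContinuousLinearMap.le_opNorm _ _).trans (mul_le_mul_of_nonneg_right
        (hC _ ⟨by linarith [hξ.1, hτ.1], by linarith [hξ.2, hτ.2]⟩) (norm_nonneg _))
    · exact ae_continuousAt_indicator_delay (fun ξ =>
        (M.continuous_expA₀.comp (continuous_add_const ξ)).clm_apply continuous_const) τ₀
  · exact continuous_toLp_zeroExt_sub y.snd

theorem zeroExt_sub_ae_eq {d : ℝ} {f g : ℝ → R2} (τ : ℝ)
    (h : f =ᵐ[delayMeasure d] g) :
    (fun ξ => (Icc (-d) 0).indicator f (ξ - τ)) =ᵐ[delayMeasure d]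
      fun ξ => (Icc (-d) 0).indicator g (ξ - τ) := by
  have h1 : (Icc (-d) 0).indicator f =ᵐ[volume] (Icc (-d) 0).indicator g := by
    filter_upwards [(ae_restrict_iff' measurableSet_Icc).1 h] with ξ hξ
    by_cases hm : ξ ∈ Icc (-d) 0
    · rw [indicator_of_mem hm, indicator_of_mem hm, hξ hm]
    · rw [indicator_of_notMem hm, indicator_of_notMem hm]
  exact ae_restrict_of_ae
    ((measurePreserving_sub_right volume τ).quasiMeasurePreserving.ae_eq_comp h1)

theorem state_ext {d : ℝ} {y z : State d} (h₁ : y.fst = z.fst) (h₂ : y.snd = z.snd) : y = z :=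
  WithLp.ofLp_injective 2 (Prod.ext h₁ h₂)

theorem semigroup_fst (τ : ℝ) (y : M.H) : (M.semigroup τ y).fst = M.expA₀ τ y.fst
    + ∫ ξ, (Icc (-τ) 0).indicator (fun ξ => M.expA₀ (τ + ξ) (y.snd ξ)) ξ ∂(delayMeasure M.d) :=
  rfl

theorem semigroup_snd (τ : ℝ) (y : M.H) : (M.semigroup τ y).snd
    = (memLp_zeroExt_sub y.snd τ).toLp (fun ξ => zeroExt y.snd (ξ - τ)) :=
  rfl

theorem semigroup_add (τ : ℝ) (y z : M.H) :
    M.semigroup τ (y + z) = M.semigroup τ y + M.semigroup τ z := by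
  refine state_ext ?_ ?_
  · rw [WithLp.add_fst, semigroup_fst, semigroup_fst, semigroup_fst, WithLp.add_fst,
      WithLp.add_snd, map_add, add_add_add_comm,
      ← integral_add (M.integrable_expA₀_snd τ y.snd) (M.integrable_expA₀_snd τ z.snd)]
    congr 1
    refine integral_congr_ae ?_
    filter_upwards [Lp.coeFn_add y.snd z.snd] with ξ hξ
    by_cases h : ξ ∈ Icc (-τ) 0
    · simp only [indicator_of_mem h, hξ, Pi.add_apply, map_add]
    · simp only [indicator_of_notMem h, add_zero]
  · rw [WithLp.add_snd, semigroup_snd, semigroup_snd, semigroup_snd, ← MemLp.toLp_add]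
    refine MemLp.toLp_congr _ _ ((zeroExt_sub_ae_eq τ (Lp.coeFn_add y.snd z.snd)).trans ?_)
    refine .of_forall fun ξ => ?_
    simp only [zeroExt, Pi.add_apply]
    rw [indicator_add']
    rfl

theorem semigroup_smul (τ c : ℝ) (y : M.H) :
    M.semigroup τ (c • y) = c • M.semigroup τ y := by
  refine state_ext ?_ ?_
  · rw [WithLp.smul_fst, semigroup_fst, semigroup_fst, WithLp.smul_fst, WithLp.smul_snd, map_smul,
      smul_add, ← integral_smul]
    congr 1
    refine integral_congr_ae ?_
    filter_upwards [Lp.coeFn_smul c y.snd] with ξ hξ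
    by_cases h : ξ ∈ Icc (-τ) 0
    · simp only [indicator_of_mem h, hξ, Pi.smul_apply, map_smul]
    · simp only [indicator_of_notMem h, smul_zero]
  · rw [WithLp.smul_snd, semigroup_snd, semigroup_snd, ← MemLp.toLp_const_smul]
    refine MemLp.toLp_congr _ _ ((zeroExt_sub_ae_eq τ (Lp.coeFn_smul c y.snd)).trans ?_)
    refine .of_forall fun ξ => ?_
    simp only [zeroExt, Pi.smul_apply]
    rw [Pi.smul_def, indicator_const_smul]

theorem toLp_zeroExt_zero_sub {d : ℝ} (τ : ℝ) :
    (memLp_zeroExt_sub (0 : Lp R2 2 (delayMeasure d)) τ).toLp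
      (fun ξ => zeroExt (0 : Lp R2 2 (delayMeasure d)) (ξ - τ)) = 0 := by
  rw [← MemLp.toLp_zero (MemLp.zero : MemLp (0 : ℝ → R2) 2 (delayMeasure d))]
  refine MemLp.toLp_congr _ _
    ((zeroExt_sub_ae_eq τ (Lp.coeFn_zero R2 2 (delayMeasure d))).trans (.of_forall fun ξ => ?_))
  simp

/-- The semigroup acts on the present `ℝ²` by the matrix exponential. -/
theorem semigroup_inState (τ : ℝ) (x : R2) :
    M.semigroup τ (inState M.d x) = inState M.d (M.expA₀ τ x) := by
  refine state_ext ?_ (toLp_zeroExt_zero_sub τ)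
  rw [semigroup_fst]
  refine add_eq_left.2 (integral_eq_zero_of_ae ?_)
  filter_upwards [Lp.coeFn_zero R2 2 (delayMeasure M.d)] with ξ hξ
  change (Icc (-τ) 0).indicator
    (fun ξ => M.expA₀ (τ + ξ) ((0 : Lp R2 2 (delayMeasure M.d)) ξ)) ξ = 0
  by_cases h : ξ ∈ Icc (-τ) 0
  · rw [indicator_of_mem h, hξ, Pi.zero_apply, map_zero]
  · rw [indicator_of_notMem h]

theorem semigroupAdj_inState (τ : ℝ) (x : R2) :
    M.semigroupAdj τ (inState M.d x) = WithLp.toLp 2 (M.expA₀Adj τ x,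
      (M.memLp_adjTail τ x).toLp ((Icc (-τ) 0).indicator (fun ξ => M.expA₀Adj (ξ + τ) x))) := by
  unfold semigroupAdj inState
  congr 2
  simp only [WithLp.toLp_fst, WithLp.toLp_snd, add_eq_left]
  have := toLp_zeroExt_zero_sub (d := M.d) (-τ)
  simpa only [sub_neg_eq_add] using this

theorem continuous_semigroupAdj_inState (x : R2) :
    Continuous fun τ => M.semigroupAdj τ (inState M.d x) := by
  simp_rw [semigroupAdj_inState]
  refine (WithLp.prod_continuous_toLp 2 _ _).comp (Continuous.prodMk ?_ ?_)
  · exact M.continuous_expA₀Adj.clm_apply continuous_const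
  · refine continuous_toLp_of_bounded _ (fun τ₀ => ?_) fun τ₀ => ?_
    · obtain ⟨C, hC⟩ := M.exists_norm_expA₀Adj_apply_le x (τ₀ - 1 - M.d) (τ₀ + 1)
      refine ⟨C, ?_⟩
      filter_upwards [Icc_mem_nhds (by linarith : τ₀ - 1 < τ₀) (by linarith : τ₀ < τ₀ + 1)]
        with τ hτ
      filter_upwards [ae_restrict_mem measurableSet_Icc] with ξ hξ
      exact (norm_indicator_le_norm_self _ _).trans
        (hC _ ⟨by linarith [hξ.1, hτ.1], by linarith [hξ.2, hτ.2]⟩)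
    · exact ae_continuousAt_indicator_delay (fun ξ =>
        (M.continuous_expA₀Adj.comp (continuous_const_add ξ)).clm_apply continuous_const) τ₀

/-- Duality of the two semigroups, tested against vectors `(x, 0)`. -/
theorem inner_semigroupAdj_inState (τ : ℝ) (x : R2) (y : M.H) :
    inner ℝ (M.semigroupAdj τ (inState M.d x)) y = inner ℝ x (M.semigroup τ y).fst := by
  rw [semigroupAdj_inState, WithLp.prod_inner_apply, semigroup_fst, inner_add_right]
  rw [← integral_inner (M.integrable_expA₀_snd τ y.snd), L2.inner_def, ← adjoint_expA₀,
    ContinuousLinearMap.adjoint_inner_left]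
  refine congrArg₂ (· + ·) rfl ?_
  refine integral_congr_ae ?_
  filter_upwards [(M.memLp_adjTail τ x).coeFn_toLp] with ξ hξ
  rw [hξ]
  by_cases h : ξ ∈ Icc (-τ) 0
  · simp only [h, indicator_of_mem]
    rw [← adjoint_expA₀, ContinuousLinearMap.adjoint_inner_left, add_comm]
    rfl
  · simp [h]

/-! ### The control operator -/

theorem inner_B (h : M.H) (x : R2) : inner ℝ h (M.B x) = inner ℝ (M.Badj h) x := by
  have hint : Integrable (fun ξ => M.b₁ ξ • h.snd ξ) (delayMeasure M.d) :=
    memLp_one_iff_integrable.1 ((Lp.memLp h.snd).smul (Lp.memLp M.b₁))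
  rw [WithLp.prod_inner_apply, Badj, inner_add_left, B]
  refine congrArg₂ (· + ·) ?_ ?_
  · rw [real_inner_smul_left]
    exact real_inner_smul_right _ _ _
  · rw [real_inner_comm x, ← integral_inner hint, L2.inner_def]
    refine integral_congr_ae ?_
    filter_upwards [(ContinuousLinearMap.toSpanSingleton ℝ x).coeFn_compLp M.b₁] with ξ hξ
    simp only [hξ, ContinuousLinearMap.toSpanSingleton_apply, real_inner_smul_left,
      real_inner_smul_right, real_inner_comm]
    rfl

theorem B_pair (p q : ℝ) :
    M.B !₂[p, q] = p • M.B !₂[1, 0] + q • M.B !₂[0, 1] := by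
  refine ext_inner_left ℝ fun h => ?_
  simp only [inner_add_right, real_inner_smul_right, inner_B]
  simp [PiLp.inner_apply, Fin.sum_univ_two]

theorem semigroup_B_pair (τ p q : ℝ) :
    M.semigroup τ (M.B !₂[p, q])
      = p • M.semigroup τ (M.B !₂[1, 0]) + q • M.semigroup τ (M.B !₂[0, 1]) := by
  rw [B_pair, semigroup_add, semigroup_smul, semigroup_smul]

end Model

end Semigroup

/-! ### Brownian motion and Wiener integrals -/

section Brownian

variable {Ω : Type*} [MeasurableSpace Ω] {P : Measure Ω} {W : ℝ≥0 → Ω → ℝ}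

theorem measurableSet_brownianFiltration_of_null [P.IsComplete] (hW : IsBrownianReal W P)
    (t : ℝ≥0) {N : Set Ω} (hN : P N = 0) : MeasurableSet[brownianFiltration P W hW t] N :=
  (le_sup_right (a := ⨆ s ≤ t, MeasurableSpace.comap (W s) inferInstance)) _
    (MeasurableSpace.measurableSet_generateFrom hN)

theorem stronglyAdapted_brownian [P.IsComplete] (hW : IsBrownianReal W P) :
    StronglyAdapted (brownianFiltration P W hW) W := by
  intro t
  refine Measurable.stronglyMeasurable ?_
  refine Measurable.mono (comap_measurable (W t)) ?_ le_rfl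
  exact le_sup_of_le_left (le_iSup₂_of_le t le_rfl le_rfl)

/-- A version of the Brownian motion all of whose paths are continuous; it is adapted because the
filtration contains the null sets. -/
theorem exists_continuous_adapted_version [P.IsComplete] (hW : IsBrownianReal W P) :
    ∃ W' : ℝ≥0 → Ω → ℝ, (∀ ω, Continuous (W' · ω)) ∧
      StronglyAdapted (brownianFiltration P W hW) W' ∧ ∀ᵐ ω ∂P, ∀ t, W' t ω = W t ω := by
  refine ⟨fun t => {ω | Continuous (W · ω)}.indicator (W t), fun ω => ?_, fun t => ?_, ?_⟩
  · by_cases h : Continuous (W · ω)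
    · exact (continuous_congr fun t =>
        indicator_of_mem (s := {ω | Continuous (W · ω)}) h (W t)).2 h
    · exact (continuous_congr fun t =>
        indicator_of_notMem (s := {ω | Continuous (W · ω)}) h (W t)).2 continuous_const
  · have hN := measurableSet_brownianFiltration_of_null hW t
      (N := {ω | Continuous (W · ω)}ᶜ) hW.cont
    exact (stronglyAdapted_brownian hW t).indicator (MeasurableSet.of_compl hN)
  · filter_upwards [hW.cont] with ω hω t
    exact indicator_of_mem (s := {ω | Continuous (W · ω)}) hω _

theorem memLp_brownian_sub (hW : IsBrownianReal W P) (a b : ℝ≥0) :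
    MemLp (fun ω => W a ω - W b ω) 2 P :=
  (hW.isGaussianProcess.hasGaussianLaw_eval a).memLp_two.sub
    (hW.isGaussianProcess.hasGaussianLaw_eval b).memLp_two

theorem integral_brownian_sub (hW : IsBrownianReal W P) (a b : ℝ≥0) :
    ∫ ω, (W a ω - W b ω) ∂P = 0 := by
  rw [integral_sub (hW.integrable_eval a) (hW.integrable_eval b), hW.integral_eval,
    hW.integral_eval, sub_zero]

theorem lintegral_sq_brownian_sub [IsProbabilityMeasure P] (hW : IsBrownianReal W P) {a b : ℝ≥0}
    (hab : a ≤ b) :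
    ∫⁻ ω, ‖W b ω - W a ω‖ₑ ^ (2 : ℝ) ∂P = ENNReal.ofReal (b - a) := by
  have h1 : Var[W b - W a; P] = (b : ℝ) - a := by
    rw [(hW.hasLaw_sub b a).variance_eq, variance_id_gaussianReal, coe_nndist, Real.dist_eq,
      abs_of_nonneg (sub_nonneg.2 (by exact_mod_cast hab))]
    rfl
  have h2 : P[W b - W a] = 0 := integral_brownian_sub hW b a
  have hm : MemLp (W b - W a) 2 P := memLp_brownian_sub hW b a
  rw [variance_of_integral_eq_zero hm.aestronglyMeasurable.aemeasurable h2] at h1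
  rw [← h1, ofReal_integral_eq_lintegral_ofReal hm.integrable_sq
    (.of_forall fun _ => sq_nonneg _)]
  refine lintegral_congr fun ω => ?_
  rw [Real.enorm_eq_ofReal_abs, ENNReal.rpow_ofNat, ← ENNReal.ofReal_pow (abs_nonneg _), sq_abs]
  rfl

theorem lintegral_sq_version_sub [IsProbabilityMeasure P] (hW : IsBrownianReal W P)
    {W' : ℝ≥0 → Ω → ℝ} (hW' : ∀ᵐ ω ∂P, ∀ t, W' t ω = W t ω) {a b : ℝ≥0} (hab : a ≤ b) :
    ∫⁻ ω, ‖W' b ω - W' a ω‖ₑ ^ (2 : ℝ) ∂P = ENNReal.ofReal (b - a) := by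
  rw [← lintegral_sq_brownian_sub hW hab]
  refine lintegral_congr_ae ?_
  filter_upwards [hW'] with ω hω
  rw [hω, hω]

variable {E : Type*} [NormedAddCommGroup E]

/-- The uniform partition of `[t, s]` into `k + 1` intervals, with the values of `Φ` at the left
end points. -/
noncomputable def leftStep (Φ : ℝ → E) {t s : ℝ≥0} (hts : t ≤ s) (k : ℕ) : StepData E t s where
  n := k + 1
  pt i := t + i * ((s - t) / (k + 1))
  mono i j hij := by
    dsimp only
    gcongr
  pt_zero := by simp
  pt_last := by
    push_cast
    rw [mul_div_cancel₀ _ (by positivity), add_tsub_cancel_of_le hts]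
  val i := Φ (t + i * ((s - t) / (k + 1)))

theorem leftStep_pt_coe {F : Type*} (Φ : ℝ → F) {t s : ℝ≥0} (hts : t ≤ s) (k i : ℕ) :
    (((leftStep Φ hts k).pt i : ℝ≥0) : ℝ) = t + i * (((s : ℝ) - t) / (k + 1)) := by
  simp only [leftStep]
  push_cast [NNReal.coe_sub hts]
  rfl

theorem leftStep_val {F : Type*} (Φ : ℝ → F) {t s : ℝ≥0} (hts : t ≤ s) (k i : ℕ) :
    (leftStep Φ hts k).val i = Φ ((leftStep Φ hts k).pt i) := by
  rw [leftStep_pt_coe]; rfl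

theorem leftStep_toFun_eq (Φ : ℝ → E) {t s : ℝ≥0} (hts : t ≤ s) {k i : ℕ} (hi : i < k + 1) {r : ℝ}
    (hr : r ∈ Ioc ((leftStep Φ hts k).pt i : ℝ) ((leftStep Φ hts k).pt (i + 1))) :
    (leftStep Φ hts k).toFun r = Φ ((leftStep Φ hts k).pt i) := by
  unfold StepData.toFun
  rw [Finset.sum_eq_single i, indicator_of_mem hr, leftStep_val]
  · intro j _ hj
    refine indicator_of_notMem (fun hr' => ?_) _
    have hmono := (leftStep Φ hts k).mono
    rcases lt_or_gt_of_ne hj with h | h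
    · have : ((leftStep Φ hts k).pt (j + 1) : ℝ) ≤ (leftStep Φ hts k).pt i :=
        NNReal.coe_le_coe.2 (hmono h)
      linarith [hr.1, hr'.2]
    · have : ((leftStep Φ hts k).pt (i + 1) : ℝ) ≤ (leftStep Φ hts k).pt j :=
        NNReal.coe_le_coe.2 (hmono h)
      linarith [hr.2, hr'.1]
  · intro h
    exact absurd (Finset.mem_range.2 hi) h

theorem exists_mem_leftStep {F : Type*} (Φ : ℝ → F) {t s : ℝ≥0} (hts : t ≤ s) (k : ℕ) {r : ℝ}
    (hr : r ∈ Ioc (t : ℝ) s) :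
    ∃ i < k + 1, r ∈ Ioc ((leftStep Φ hts k).pt i : ℝ) ((leftStep Φ hts k).pt (i + 1)) := by
  have h1 : r ∈ Ioc ((leftStep Φ hts k).pt 0 : ℝ) ((leftStep Φ hts k).pt (k + 1)) := by
    rw [(leftStep Φ hts k).pt_zero, show (leftStep Φ hts k).pt (k + 1) = s from
      (leftStep Φ hts k).pt_last]
    exact hr
  have h2 := Ioc_subset_biUnion_Ioc (k + 1) (fun i => ((leftStep Φ hts k).pt i : ℝ)) h1
  simpa only [mem_iUnion, exists_prop, Finset.mem_range] using h2

variable [NormedSpace ℝ E]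

/-- Wiener integrals have mean zero. -/
theorem IsWienerIntegral.integral_eq_zero [CompleteSpace E] [IsProbabilityMeasure P]
    (hW : IsBrownianReal W P) {t s : ℝ≥0} {Φ : ℝ → E} {I : Ω → E}
    (h : IsWienerIntegral P W t s Φ I) :
    ∫ ω, I ω ∂P = 0 := by
  obtain ⟨-, hI, φ, -, hφ⟩ := h
  have hmem : ∀ k, MemLp ((φ k).integral W) 2 P := fun k =>
    memLp_finsetSum _ fun i _ =>
      (ContinuousLinearMap.toSpanSingleton ℝ ((φ k).val i)).comp_memLp' (memLp_brownian_sub hW _ _)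
  have hzero : ∀ k, ∫ ω, (φ k).integral W ω ∂P = 0 := by
    intro k
    unfold StepData.integral
    rw [integral_finsetSum _ fun i _ =>
      ((memLp_brownian_sub hW _ _).integrable (by norm_num)).smul_const _]
    refine Finset.sum_eq_zero fun i _ => ?_
    rw [integral_smul_const, integral_brownian_sub hW, zero_smul]
  have hlim : Tendsto (fun k => eLpNorm ((φ k).integral W - I) 1 P) atTop (𝓝 0) := by
    refine tendsto_of_tendsto_of_tendsto_of_le_of_le tendsto_const_nhds hφ
      (fun _ => zero_le) fun k => ?_
    rw [eLpNorm_sub_comm]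
    exact eLpNorm_le_eLpNorm_of_exponent_le (by norm_num) (hI.1.sub (hmem k).1)
  have := tendsto_integral_of_L1' I hI.1
    (.of_forall fun k => (hmem k).integrable (by norm_num)) hlim
  simp_rw [hzero] at this
  exact (tendsto_nhds_unique this tendsto_const_nhds)

/-- Summation by parts. -/
theorem sum_sub_smul_eq (x : ℕ → ℝ) (v : ℕ → E) (n : ℕ) :
    ∑ i ∈ Finset.range n, (x (i + 1) - x i) • v i
      = (x n - x 0) • v n - ∑ i ∈ Finset.range n, (x (i + 1) - x 0) • (v (i + 1) - v i) := by
  induction n with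
  | zero => simp
  | succ n ih =>
    rw [Finset.sum_range_succ, Finset.sum_range_succ, ih]
    module

/-- The integral of a Brownian increment over a short interval is of order `3/2` in its length. -/
theorem eLpNorm_integral_brownian_sub_le [IsProbabilityMeasure P] (hW : IsBrownianReal W P)
    {W' : ℝ≥0 → Ω → ℝ} (hc : ∀ ω, Continuous (W' · ω)) (hm : ∀ s, Measurable (W' s))
    (hW' : ∀ᵐ ω ∂P, ∀ t, W' t ω = W t ω) {a b : ℝ≥0} (hab : a ≤ b) {Ψ : ℝ → E}
    (hΨ : Continuous Ψ) {C : ℝ} (hC : ∀ r ∈ Icc (a : ℝ) b, ‖Ψ r‖ ≤ C) :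
    eLpNorm (fun ω => ∫ r in (a : ℝ)..b, (W' b ω - W' r.toNNReal ω) • Ψ r) 2 P
      ≤ ENNReal.ofReal (b - a) ^ (1 / 2 : ℝ) * (ENNReal.ofReal C * ENNReal.ofReal (b - a)) := by
  have hab' : (a : ℝ) ≤ b := by exact_mod_cast hab
  set F : ℝ × Ω → E := fun p => (W' b p.2 - W' p.1.toNNReal p.2) • Ψ p.1 with hF
  have hWm : Measurable fun p : ℝ × Ω => W' p.1.toNNReal p.2 :=
    (stronglyMeasurable_uncurry_of_continuous_of_stronglyMeasurable hc
      fun s => (hm s).stronglyMeasurable).measurable.comp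
      (measurable_fst.real_toNNReal.prodMk measurable_snd)
  have hFm : StronglyMeasurable F :=
    (((hm b).comp measurable_snd).sub hWm).stronglyMeasurable.smul
      (hΨ.stronglyMeasurable.comp_measurable measurable_fst)
  have h1 : eLpNorm (fun ω => ∫ r in (a : ℝ)..b, (W' b ω - W' r.toNNReal ω) • Ψ r) 2 P
      ≤ eLpNorm (fun ω => ∫ r, ‖F (r, ω)‖ ∂(volume.restrict (Ioc (a : ℝ) b))) 2 P := by
    refine eLpNorm_mono_real fun ω => ?_
    rw [intervalIntegral.integral_of_le hab']
    exact norm_integral_le_integral_norm _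
  refine h1.trans ((eLpNorm_integral_norm_le hFm.aestronglyMeasurable).trans ?_)
  rw [Measure.restrict_apply_univ, Real.volume_Ioc]
  gcongr
  rw [eLpNorm_eq_lintegral_rpow_enorm_toReal two_ne_zero ENNReal.ofNat_ne_top,
    lintegral_prod _ (hFm.aestronglyMeasurable.enorm.pow_const _)]
  simp only [ENNReal.toReal_ofNat]
  have h2 : ∀ᵐ r ∂(volume.restrict (Ioc (a : ℝ) b)), ∫⁻ ω, ‖F (r, ω)‖ₑ ^ (2 : ℝ) ∂P
      ≤ ENNReal.ofReal (b - a) * ENNReal.ofReal C ^ (2 : ℝ) := by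
    filter_upwards [ae_restrict_mem measurableSet_Ioc] with r hr
    have hr0 : 0 ≤ r := a.2.trans hr.1.le
    have hrb : r.toNNReal ≤ b := Real.toNNReal_le_iff_le_coe.2 hr.2
    simp only [hF, enorm_smul]
    simp_rw [ENNReal.mul_rpow_of_nonneg _ _ (show (0 : ℝ) ≤ 2 by norm_num)]
    rw [lintegral_mul_const' _ _ (by simp), lintegral_sq_version_sub hW hW' hrb,
      Real.coe_toNNReal _ hr0]
    gcongr
    · exact hr.1.le
    · rw [← ofReal_norm]
      exact ENNReal.ofReal_le_ofReal (hC r ⟨hr.1.le, hr.2⟩)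
  calc _ ≤ (∫⁻ _ in Ioc (a : ℝ) b,
          ENNReal.ofReal (b - a) * ENNReal.ofReal C ^ (2 : ℝ)) ^ (1 / 2 : ℝ) :=
        ENNReal.rpow_le_rpow (lintegral_mono_ae h2) (by norm_num)
    _ = (ENNReal.ofReal C * ENNReal.ofReal (b - a)) ^ ((2 : ℝ) * (1 / 2)) := by
        rw [lintegral_const, Measure.restrict_apply_univ, Real.volume_Ioc, ENNReal.rpow_mul,
          ENNReal.mul_rpow_of_nonneg _ _ (show (0 : ℝ) ≤ 2 by norm_num)]
        congr 1
        rw [ENNReal.rpow_ofNat, ENNReal.rpow_ofNat]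
        ring
    _ = _ := by norm_num

/-- The difference between the integral obtained by partial integration and the elementary integral
of the left-endpoint step function is a sum over the intervals of the partition, by summation by
parts of the elementary integral. -/
theorem byParts_sub_leftStep [CompleteSpace E] {W' : ℝ≥0 → ℝ} (hc : Continuous W')
    {t s : ℝ≥0} (hts : t ≤ s) {Φ Φ' : ℝ → E} (hΦ : ∀ r, HasDerivAt Φ (Φ' r) r) (hΦ' : Continuous Φ')
    (k : ℕ) :
    ((W' s - W' t) • Φ s - ∫ r in (t : ℝ)..s, (W' r.toNNReal - W' t) • Φ' r)
      - ∑ i ∈ Finset.range (k + 1), (W' ((leftStep Φ hts k).pt (i + 1))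
          - W' ((leftStep Φ hts k).pt i)) • (leftStep Φ hts k).val i
      = ∑ i ∈ Finset.range (k + 1),
          ∫ r in ((leftStep Φ hts k).pt i : ℝ)..((leftStep Φ hts k).pt (i + 1)),
            (W' ((leftStep Φ hts k).pt (i + 1)) - W' r.toNNReal) • Φ' r := by
  set p := (leftStep Φ hts k).pt with hp
  have hp0 : p 0 = t := (leftStep Φ hts k).pt_zero
  have hpn : p (k + 1) = s := (leftStep Φ hts k).pt_last
  have hint : ∀ a b c : ℝ, IntervalIntegrable (fun r => (W' r.toNNReal - c) • Φ' r) volume a b :=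
    fun a b c => Continuous.intervalIntegrable (by fun_prop) _ _
  have hsplit : ∫ r in (t : ℝ)..s, (W' r.toNNReal - W' t) • Φ' r
      = ∑ i ∈ Finset.range (k + 1), ∫ r in (p i : ℝ)..(p (i + 1)),
          (W' r.toNNReal - W' t) • Φ' r := by
    rw [intervalIntegral.sum_integral_adjacent_intervals (a := fun i => (p i : ℝ))
      fun i _ => hint _ _ _, hp0, hpn]
  simp_rw [leftStep_val]
  rw [← hp, sum_sub_smul_eq (fun i => W' (p i)) (fun i => Φ (p i)) (k + 1), hsplit]
  simp only [hp0, hpn]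
  rw [sub_sub_sub_cancel_left, ← Finset.sum_sub_distrib]
  refine Finset.sum_congr rfl fun i _ => ?_
  rw [← intervalIntegral.integral_eq_sub_of_hasDerivAt (fun r _ => hΦ r)
    (hΦ'.intervalIntegrable _ _), ← intervalIntegral.integral_smul,
    ← intervalIntegral.integral_sub (Continuous.intervalIntegrable (by fun_prop) _ _) (hint _ _ _)]
  refine intervalIntegral.integral_congr fun r _ => ?_
  module

/-- The Wiener integral of a continuously differentiable integrand, by partial integration:
`∫_t^s Φ dW = (W_s - W_t) Φ(s) - ∫_t^s (W_r - W_t) Φ'(r) dr`. -/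
theorem isWienerIntegral_byParts [CompleteSpace E] [IsProbabilityMeasure P]
    (hW : IsBrownianReal W P) {W' : ℝ≥0 → Ω → ℝ} (hc : ∀ ω, Continuous (W' · ω))
    (hm : ∀ s, Measurable (W' s)) (hW' : ∀ᵐ ω ∂P, ∀ t, W' t ω = W t ω) {t s : ℝ≥0} (hts : t ≤ s)
    {Φ Φ' : ℝ → E}
    (hΦ : ∀ r, HasDerivAt Φ (Φ' r) r) (hΦ' : Continuous Φ')
    (hI : MemLp (fun ω => (W' s ω - W' t ω) • Φ s
      - ∫ r in (t : ℝ)..s, (W' r.toNNReal ω - W' t ω) • Φ' r) 2 P) :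
    IsWienerIntegral P W t s Φ (fun ω => (W' s ω - W' t ω) • Φ s
      - ∫ r in (t : ℝ)..s, (W' r.toNNReal ω - W' t ω) • Φ' r) := by
  have hts' : (t : ℝ) ≤ s := by exact_mod_cast hts
  have hΦc : Continuous Φ := continuous_iff_continuousAt.2 fun r => (hΦ r).continuousAt
  obtain ⟨C, hC⟩ := (isCompact_Icc (a := (t : ℝ)) (b := s)).exists_bound_of_continuousOn
    hΦ'.continuousOn
  have hC0 : 0 ≤ C := (norm_nonneg _).trans (hC t ⟨le_rfl, hts'⟩)
  have hgap : ∀ k i, ((leftStep Φ hts k).pt (i + 1) : ℝ) - (leftStep Φ hts k).pt i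
      = (s - t) / (k + 1) := by
    intro k i
    rw [leftStep_pt_coe, leftStep_pt_coe]
    push_cast
    ring
  have hlim0 : Tendsto (fun k : ℕ => ((s : ℝ) - t) / (k + 1)) atTop (𝓝 0) :=
    tendsto_const_nhds.div_atTop (tendsto_natCast_atTop_atTop.atTop_add tendsto_const_nhds)
  refine ⟨?_, hI, leftStep Φ hts, ?_, ?_⟩
  · obtain ⟨D, hD⟩ := (isCompact_Icc (a := (t : ℝ)) (b := s)).exists_bound_of_continuousOn
      hΦc.continuousOn
    refine MemLp.of_bound hΦc.aestronglyMeasurable D ?_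
    filter_upwards [ae_restrict_mem measurableSet_Ioc] with r hr
    exact hD r ⟨hr.1.le, hr.2⟩
  · have hb : ∀ k : ℕ, eLpNorm (fun r => Φ r - (leftStep Φ hts k).toFun r) 2
        (volume.restrict (Ioc (t : ℝ) s))
        ≤ (volume.restrict (Ioc (t : ℝ) s)) univ ^ (ENNReal.toReal 2)⁻¹
          * ENNReal.ofReal (C * ((s - t) / (k + 1))) := by
      intro k
      refine eLpNorm_le_of_ae_bound ?_
      filter_upwards [ae_restrict_mem measurableSet_Ioc] with r hr
      obtain ⟨i, hi, hri⟩ := exists_mem_leftStep Φ hts k hr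
      rw [leftStep_toFun_eq Φ hts hi hri]
      have h0 : (t : ℝ) ≤ (leftStep Φ hts k).pt i := by
        have := (leftStep Φ hts k).mono (Nat.zero_le i)
        rw [(leftStep Φ hts k).pt_zero] at this
        exact_mod_cast this
      have hle := (convex_Icc (t : ℝ) s).norm_image_sub_le_of_norm_hasDerivWithin_le
        (fun x _ => (hΦ x).hasDerivWithinAt) hC ⟨h0, hri.1.le.trans hr.2⟩ ⟨hr.1.le, hr.2⟩
      refine hle.trans (mul_le_mul_of_nonneg_left ?_ hC0)
      rw [Real.norm_of_nonneg (by linarith [hri.1]), ← hgap k i]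
      linarith [hri.2]
    refine tendsto_of_tendsto_of_tendsto_of_le_of_le tendsto_const_nhds ?_ (fun _ => zero_le) hb
    have h1 := ENNReal.tendsto_ofReal (hlim0.const_mul C)
    rw [mul_zero, ENNReal.ofReal_zero] at h1
    have h2 := ENNReal.Tendsto.const_mul
      (a := (volume.restrict (Ioc (t : ℝ) s)) univ ^ (ENNReal.toReal 2)⁻¹) h1
      (Or.inr (by
        rw [Measure.restrict_apply_univ, Real.volume_Ioc]
        exact ENNReal.rpow_ne_top_of_nonneg (by positivity) ENNReal.ofReal_ne_top))
    rwa [mul_zero] at h2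
  · have hb : ∀ k : ℕ, eLpNorm (fun ω => ((W' s ω - W' t ω) • Φ s
        - ∫ r in (t : ℝ)..s, (W' r.toNNReal ω - W' t ω) • Φ' r)
          - (leftStep Φ hts k).integral W ω) 2 P
        ≤ ENNReal.ofReal ((s - t) / (k + 1)) ^ (1 / 2 : ℝ)
          * (ENNReal.ofReal C * ENNReal.ofReal (s - t)) := by
      intro k
      have hae : (fun ω => ((W' s ω - W' t ω) • Φ s
          - ∫ r in (t : ℝ)..s, (W' r.toNNReal ω - W' t ω) • Φ' r)
            - (leftStep Φ hts k).integral W ω) =ᵐ[P]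
          ∑ i ∈ Finset.range (k + 1), fun ω =>
            ∫ r in ((leftStep Φ hts k).pt i : ℝ)..((leftStep Φ hts k).pt (i + 1)),
              (W' ((leftStep Φ hts k).pt (i + 1)) ω - W' r.toNNReal ω) • Φ' r := by
        filter_upwards [hW'] with ω hω
        rw [Finset.sum_apply, ← byParts_sub_leftStep (hc ω) hts hΦ hΦ' k]
        congr 1
        refine Finset.sum_congr rfl fun i _ => ?_
        rw [hω, hω]
      rw [eLpNorm_congr_ae hae]
      have hmeas : ∀ a b : ℝ≥0, AEStronglyMeasurable (fun ω =>
          ∫ r in (a : ℝ)..b, (W' b ω - W' r.toNNReal ω) • Φ' r) P := by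
        intro a b
        have hWm : Measurable fun p : Ω × ℝ => W' p.2.toNNReal p.1 :=
          (stronglyMeasurable_uncurry_of_continuous_of_stronglyMeasurable hc
            fun s => (hm s).stronglyMeasurable).measurable.comp
            (measurable_snd.real_toNNReal.prodMk measurable_fst)
        have hFm : StronglyMeasurable fun p : Ω × ℝ =>
            (W' b p.1 - W' p.2.toNNReal p.1) • Φ' p.2 :=
          (((hm b).comp measurable_fst).sub hWm).stronglyMeasurable.smul
            (hΦ'.stronglyMeasurable.comp_measurable measurable_snd)
        simp only [intervalIntegral]
        exact (hFm.integral_prod_right'.sub hFm.integral_prod_right').aestronglyMeasurable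
      refine (eLpNorm_sum_le (fun i _ => hmeas _ _) (by norm_num)).trans ?_
      have hpiece : ∀ i ∈ Finset.range (k + 1), eLpNorm (fun ω =>
          ∫ r in ((leftStep Φ hts k).pt i : ℝ)..((leftStep Φ hts k).pt (i + 1)),
            (W' ((leftStep Φ hts k).pt (i + 1)) ω - W' r.toNNReal ω) • Φ' r) 2 P
          ≤ ENNReal.ofReal ((s - t) / (k + 1)) ^ (1 / 2 : ℝ)
            * (ENNReal.ofReal C * ENNReal.ofReal ((s - t) / (k + 1))) := by
        intro i hi
        have hmono := (leftStep Φ hts k).mono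
        have h0 : (t : ℝ) ≤ (leftStep Φ hts k).pt i := by
          have := hmono (Nat.zero_le i)
          rw [(leftStep Φ hts k).pt_zero] at this
          exact_mod_cast this
        have h1 : ((leftStep Φ hts k).pt (i + 1) : ℝ) ≤ s := by
          have := hmono (show i + 1 ≤ k + 1 by have := Finset.mem_range.1 hi; omega)
          rw [show (leftStep Φ hts k).pt (k + 1) = s from (leftStep Φ hts k).pt_last] at this
          exact_mod_cast this
        have := eLpNorm_integral_brownian_sub_le hW hc hm hW' (hmono (Nat.le_succ i)) hΦ'
          fun r hr => hC r ⟨h0.trans hr.1, hr.2.trans h1⟩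
        rwa [hgap] at this
      -- `k + 1` pieces of size `((s - t) / (k + 1)) ^ (3 / 2)` each
      refine (Finset.sum_le_sum hpiece).trans (le_of_eq ?_)
      rw [Finset.sum_const, Finset.card_range, nsmul_eq_mul]
      have hk : ((k + 1 : ℕ) : ℝ≥0∞) * ENNReal.ofReal ((s - t) / (k + 1))
          = ENNReal.ofReal (s - t) := by
        rw [← ENNReal.ofReal_natCast, ← ENNReal.ofReal_mul (by positivity)]
        congr 1
        push_cast
        field_simp
      rw [← hk]
      ring
    refine tendsto_of_tendsto_of_tendsto_of_le_of_le tendsto_const_nhds ?_ (fun _ => zero_le) hb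
    have h1 := ENNReal.tendsto_ofReal hlim0
    rw [ENNReal.ofReal_zero] at h1
    have h2 := ((ENNReal.continuous_rpow_const (y := 1 / 2)).tendsto 0).comp h1
    rw [ENNReal.zero_rpow_of_pos (by norm_num)] at h2
    have h3 := ENNReal.Tendsto.mul_const (b := ENNReal.ofReal C * ENNReal.ofReal (s - t)) h2
      (Or.inr (ENNReal.mul_ne_top ENNReal.ofReal_ne_top ENNReal.ofReal_ne_top))
    rwa [zero_mul] at h3

end Brownian

/-! ### Existence of the mild solution -/

section MildSolution

variable {Ω : Type*} [MeasurableSpace Ω] {P : Measure Ω} {W : ℝ≥0 → Ω → ℝ}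
  {E : Type*} [NormedAddCommGroup E]

theorem stronglyMeasurable_of_continuous_adapted
    {F : Filtration ℝ≥0 (inferInstance : MeasurableSpace Ω)}
    {C : ℝ≥0 → Ω → E} (hc : ∀ ω, Continuous (C · ω)) (ha : StronglyAdapted F C) :
    StronglyMeasurable fun p : ℝ × Ω => C p.1.toNNReal p.2 :=
  (stronglyMeasurable_uncurry_of_continuous_of_stronglyMeasurable hc
    fun s => (ha s).mono (F.le s)).comp_measurable
    (measurable_fst.real_toNNReal.prodMk measurable_snd)

variable [NormedSpace ℝ E]

theorem memLp_and_integral_of_ae_eq [CompleteSpace E] [IsProbabilityMeasure P]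
    {Y A B I : Ω → E} {c : E}
    (hA : MemLp A 2 P) (hB : MemLp B 2 P) (hI : MemLp I 2 P) (hI0 : ∫ ω, I ω ∂P = 0)
    (hY : Y =ᵐ[P] fun ω => c + (A ω + B ω) + I ω) :
    MemLp Y 2 P ∧ ∫ ω, Y ω ∂P = c + ((∫ ω, A ω ∂P) + ∫ ω, B ω ∂P) := by
  have hAi : Integrable A P := hA.integrable (by norm_num)
  have hBi : Integrable B P := hB.integrable (by norm_num)
  have hAB : Integrable (fun ω => A ω + B ω) P := hAi.add hBi
  have hcAB : Integrable (fun ω => c + (A ω + B ω)) P := (integrable_const c).add hAB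
  refine ⟨MemLp.ae_eq hY.symm (((memLp_const c).add (hA.add hB)).add hI), ?_⟩
  rw [integral_congr_ae hY, integral_add hcAB
    (hI.integrable (by norm_num)), hI0, add_zero, integral_add (integrable_const c) hAB,
    integral_add hAi hBi, integral_const, probReal_univ, one_smul]

namespace Model

variable {M : Model}

theorem Admissible.memLp_Ioc [SFinite P] [P.IsComplete] {hW : IsBrownianReal W P} {U : ℝ≥0 → Ω → ℝ}
    (hU : M.Admissible P W hW U) (t : ℝ≥0) {s : ℝ≥0} (hs : s ≤ M.T) :
    MemLp (fun p : ℝ × Ω => U p.1.toNNReal p.2) 2 ((volume.restrict (Ioc (t : ℝ) s)).prod P) := by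
  refine hU.2.mono_measure ?_
  refine Measure.prod_mono (Measure.restrict_mono ?_ le_rfl) le_rfl
  exact fun r hr => ⟨t.2.trans hr.1.le, hr.2.trans (by exact_mod_cast hs)⟩

theorem Admissible.ae_integrableOn [IsProbabilityMeasure P] [P.IsComplete]
    {hW : IsBrownianReal W P} {U : ℝ≥0 → Ω → ℝ}
    (hU : M.Admissible P W hW U) (t : ℝ≥0) {s : ℝ≥0} (hs : s ≤ M.T) :
    ∀ᵐ ω ∂P, IntegrableOn (fun r => U r.toNNReal ω) (Ioc (t : ℝ) s) :=
  ((hU.memLp_Ioc t hs).integrable (by norm_num)).prod_left_ae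

theorem Admissible.integrable_smul [IsProbabilityMeasure P] [P.IsComplete]
    {hW : IsBrownianReal W P} {U : ℝ≥0 → Ω → ℝ} (hU : M.Admissible P W hW U) (t : ℝ≥0) {s : ℝ≥0}
    (hs : s ≤ M.T) {k : ℝ → E} (hk : Continuous k) :
    Integrable (fun p : ℝ × Ω => U p.1.toNNReal p.2 • k p.1)
      ((volume.restrict (Ioc (t : ℝ) s)).prod P) := by
  obtain ⟨C, hC⟩ := (isCompact_Icc (a := (t : ℝ)) (b := s)).exists_bound_of_continuousOn
    hk.continuousOn
  refine ((hU.memLp_Ioc t hs).integrable (by norm_num)).smul_bdd C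
    (hk.stronglyMeasurable.comp_measurable measurable_fst).aestronglyMeasurable ?_
  have h := ae_restrict_mem (μ := (volume : Measure ℝ)) (measurableSet_Ioc (a := (t : ℝ)) (b := s))
  have h' := Measure.quasiMeasurePreserving_fst (μ := volume.restrict (Ioc (t : ℝ) s)) (ν := P)
    |>.ae h
  filter_upwards [h'] with p hp
  exact hC _ ⟨hp.1.le, hp.2⟩

/-- Fubini for the drift: its mean is the drift of the mean control. -/
theorem Admissible.integral_integral_smul [CompleteSpace E] [IsProbabilityMeasure P] [P.IsComplete]
    {hW : IsBrownianReal W P} {U : ℝ≥0 → Ω → ℝ} (hU : M.Admissible P W hW U) {t s : ℝ≥0}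
    (hts : t ≤ s) (hs : s ≤ M.T) {k : ℝ → E} (hk : Continuous k) :
    ∫ ω, (∫ r in (t : ℝ)..s, U r.toNNReal ω • k r) ∂P
      = ∫ r in (t : ℝ)..s, (∫ ω, U r.toNNReal ω ∂P) • k r := by
  have hts' : (t : ℝ) ≤ s := by exact_mod_cast hts
  simp_rw [intervalIntegral.integral_of_le hts']
  rw [← integral_integral_swap (hU.integrable_smul t hs hk)]
  refine integral_congr_ae ?_
  refine .of_forall fun r => ?_
  exact integral_smul_const _ _

/-- The convolution of an admissible process with a continuous kernel has a version which is
continuous, adapted and square integrable. -/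
theorem Admissible.exists_conv [IsProbabilityMeasure P] [P.IsComplete]
    {hW : IsBrownianReal W P} {U : ℝ≥0 → Ω → ℝ} (hU : M.Admissible P W hW U) {t : ℝ≥0}
    (ht : t ≤ M.T) {k : ℝ → E} (hk : Continuous k) :
    ∃ C : ℝ≥0 → Ω → E, (∀ ω, Continuous (C · ω)) ∧
      StronglyAdapted (brownianFiltration P W hW) C ∧
      MemLp (fun p : ℝ × Ω => C p.1.toNNReal p.2) 2
        ((volume.restrict (Icc (t : ℝ) M.T)).prod P) ∧
      (∀ s ∈ Icc t M.T, MemLp (C s) 2 P) ∧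
      ∀ᵐ ω ∂P, ∀ s ∈ Icc t M.T, C s ω = ∫ r in (t : ℝ)..s, U r.toNNReal ω • k (s - r) := by
  have ht' : (t : ℝ) ≤ M.T := by exact_mod_cast ht
  -- the paths which are not integrable form a null set, which belongs to every `F_s`
  set good : Set Ω := {ω | IntegrableOn (fun r => U r.toNNReal ω) (Ioc (t : ℝ) M.T)} with hgood
  have hae : ∀ᵐ ω ∂P, ω ∈ good := hU.ae_integrableOn t le_rfl
  set C : ℝ≥0 → Ω → E := fun s => good.indicator
    fun ω => conv t M.T (fun r => U r.toNNReal ω) k s with hC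
  have hcont : ∀ ω, Continuous (C · ω) := by
    intro ω
    by_cases h : ω ∈ good
    · exact (continuous_congr fun s => indicator_of_mem h _).2
        ((continuous_conv h hk).comp NNReal.continuous_coe)
    · exact (continuous_congr fun s => indicator_of_notMem h _).2 continuous_const
  have hadapt : StronglyAdapted (brownianFiltration P W hW) C := by
    intro s
    have hN := measurableSet_brownianFiltration_of_null hW s (N := goodᶜ) hae
    exact (@stronglyMeasurable_conv E _ _ Ω (brownianFiltration P W hW s) U s (hU.1 s) k hk
      t M.T).indicator (MeasurableSet.of_compl hN)
  have hjoint := stronglyMeasurable_of_continuous_adapted hcont hadapt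
  obtain ⟨K, hK⟩ := (isCompact_Icc (a := (0 : ℝ)) (b := M.T - t)).exists_bound_of_continuousOn
    hk.continuousOn
  have hg : MemLp (fun ω => K * ∫ r in Ioc (t : ℝ) M.T, ‖U r.toNNReal ω‖) 2 P :=
    (memLp_integral_norm (hU.memLp_Ioc t le_rfl)).const_mul K
  have hbound : ∀ s ∈ Icc (t : ℝ) M.T, ∀ ω, ‖C s.toNNReal ω‖
      ≤ ‖K * ∫ r in Ioc (t : ℝ) M.T, ‖U r.toNNReal ω‖‖ := by
    intro s hs ω
    by_cases h : ω ∈ good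
    · have hCs : C s.toNNReal ω = conv t M.T (fun r => U r.toNNReal ω) k s.toNNReal :=
        indicator_of_mem h _
      rw [hCs, Real.coe_toNNReal _ (t.2.trans hs.1)]
      exact (norm_conv_le h hs hK).trans (le_abs_self _)
    · have hCs : C s.toNNReal ω = 0 := indicator_of_notMem h _
      rw [hCs, norm_zero]
      exact norm_nonneg _
  refine ⟨C, hcont, hadapt, ?_, ?_, ?_⟩
  · refine (hg.comp_snd (volume.restrict (Icc (t : ℝ) M.T))).mono hjoint.aestronglyMeasurable ?_
    have h' := Measure.quasiMeasurePreserving_fst (μ := volume.restrict (Icc (t : ℝ) M.T)) (ν := P)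
      |>.ae (ae_restrict_mem measurableSet_Icc)
    filter_upwards [h'] with p hp using hbound _ hp _
  · intro s hs
    refine hg.mono ((hadapt s).mono ((brownianFiltration P W hW).le s)).aestronglyMeasurable
      (.of_forall fun ω => ?_)
    have := hbound s ⟨by exact_mod_cast hs.1, by exact_mod_cast hs.2⟩ ω
    rwa [Real.toNNReal_coe] at this
  · filter_upwards [hae] with ω hω s hs
    have hCs : C s ω = conv t M.T (fun r => U r.toNNReal ω) k s := indicator_of_mem hω _
    rw [hCs]
    exact conv_eq_intervalIntegral ⟨by exact_mod_cast hs.1, by exact_mod_cast hs.2⟩ _ _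

/-- Brownian increments after time `t` form an admissible process. The base point is `min t s`, so
that the process vanishes, and hence is adapted, before time `t`. -/
theorem admissible_brownian_increment [IsProbabilityMeasure P] [P.IsComplete]
    (hW : IsBrownianReal W P) {W' : ℝ≥0 → Ω → ℝ} (hc : ∀ ω, Continuous (W' · ω))
    (ha : StronglyAdapted (brownianFiltration P W hW) W')
    (hW' : ∀ᵐ ω ∂P, ∀ t, W' t ω = W t ω) (t : ℝ≥0) :
    (∀ ω, Continuous fun s => W' s ω - W' (min t s) ω) ∧
    StronglyAdapted (brownianFiltration P W hW) (fun s ω => W' s ω - W' (min t s) ω) ∧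
    M.Admissible P W hW (fun s ω => W' s ω - W' (min t s) ω) := by
  have h1 : ∀ ω, Continuous fun s => W' s ω - W' (min t s) ω := fun ω =>
    (hc ω).sub ((hc ω).comp (by fun_prop))
  have h2 : StronglyAdapted (brownianFiltration P W hW) (fun s ω => W' s ω - W' (min t s) ω) :=
    fun s => (ha s).sub ((ha _).mono ((brownianFiltration P W hW).mono (min_le_right _ _)))
  have h3 := stronglyMeasurable_of_continuous_adapted h1 h2
  refine ⟨h1, h2, h2.isStronglyProgressive_of_continuous h1, h3.aestronglyMeasurable, ?_⟩
  rw [eLpNorm_lt_top_iff_lintegral_rpow_enorm_lt_top two_ne_zero ENNReal.ofNat_ne_top,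
    lintegral_prod _ (h3.aestronglyMeasurable.enorm.pow_const _)]
  have hb : ∀ᵐ r ∂(volume.restrict (Icc (0 : ℝ) M.T)),
      ∫⁻ ω, ‖W' r.toNNReal ω - W' (min t r.toNNReal) ω‖ₑ ^ (ENNReal.toReal 2) ∂P
        ≤ ENNReal.ofReal M.T := by
    filter_upwards [ae_restrict_mem measurableSet_Icc] with r hr
    simp only [ENNReal.toReal_ofNat]
    rw [lintegral_sq_version_sub hW hW' (min_le_right t r.toNNReal)]
    refine ENNReal.ofReal_le_ofReal ?_
    rw [Real.coe_toNNReal _ hr.1]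
    exact (sub_le_self _ (NNReal.coe_nonneg _)).trans hr.2
  refine (lintegral_mono_ae hb).trans_lt ?_
  rw [lintegral_const]
  exact ENNReal.mul_lt_top ENNReal.ofReal_lt_top (measure_lt_top _ _)

variable [IsProbabilityMeasure P] [P.IsComplete]

/-- The drift term of the mild formula splits into the contributions of the two controls. -/
theorem ae_drift_eq {hW : IsBrownianReal W P} {u z : ℝ≥0 → Ω → ℝ}
    (hu : M.Admissible P W hW u) (hz : M.Admissible P W hW z) (t : ℝ≥0) :
    ∀ᵐ ω ∂P, ∀ s ∈ Icc t M.T,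
      ∫ r in (t : ℝ)..s, M.semigroup (s - r) (M.B (pair u z r.toNNReal ω))
        = (∫ r in (t : ℝ)..s, u r.toNNReal ω • M.semigroup (s - r) (M.B !₂[1, 0]))
          + ∫ r in (t : ℝ)..s, z r.toNNReal ω • M.semigroup (s - r) (M.B !₂[0, 1]) := by
  filter_upwards [hu.ae_integrableOn t le_rfl, hz.ae_integrableOn t le_rfl] with ω h1 h2 s hs
  have hts : (t : ℝ) ≤ s := by exact_mod_cast hs.1
  have hi : ∀ {U : ℝ → ℝ} (h : M.H), IntegrableOn U (Ioc (t : ℝ) M.T) →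
      IntervalIntegrable (fun r => U r • M.semigroup (s - r) h) volume t s := by
    intro U h hU
    have hU' : IntervalIntegrable U volume t s :=
      (intervalIntegrable_iff_integrableOn_Ioc_of_le hts).2
        (hU.mono_set (Ioc_subset_Ioc_right (by exact_mod_cast hs.2)))
    exact hU'.smul_continuousOn
      ((M.continuous_semigroup h).comp (continuous_sub_left (s : ℝ))).continuousOn
  rw [← intervalIntegral.integral_add (hi _ h1) (hi _ h2)]
  refine intervalIntegral.integral_congr fun r _ => ?_
  exact M.semigroup_B_pair _ _ _

/-- The noise enters through the smooth path `τ ↦ e^{τA} G 1`. -/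
theorem semigroup_G (τ : ℝ) : M.semigroup τ (M.G 1) = inState M.d (M.expA₀ τ !₂[M.σ * 1, 0]) :=
  M.semigroup_inState τ _

/-- Existence of the mild solution: the mild formula, with each integral replaced by its continuous
adapted version. -/
theorem exists_isMildSolution (hW : IsBrownianReal W P) {t : ℝ≥0} (ht : t ≤ M.T) (y : M.H)
    {u z : ℝ≥0 → Ω → ℝ} (hu : M.Admissible P W hW u) (hz : M.Admissible P W hW z) :
    ∃ Y, M.IsMildSolution P W hW t y (pair u z) Y := by
  obtain ⟨W', hWc, hWa, hWW⟩ := exists_continuous_adapted_version hW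
  obtain ⟨hXc, hXa, hX⟩ := admissible_brownian_increment (M := M) hW hWc hWa hWW t
  -- `N τ = e^{τA} G 1` and its derivative
  let incl : R2 →L[ℝ] M.H :=
    (WithLp.prodContinuousLinearEquiv 2 ℝ R2
        (Lp R2 2 (delayMeasure M.d))).symm.toContinuousLinearMap
      ∘L ContinuousLinearMap.inl ℝ R2 (Lp R2 2 (delayMeasure M.d))
  let e : R2 := !₂[M.σ * 1, 0]
  let N : ℝ → M.H := fun τ => incl (M.expA₀ τ e)
  let N' : ℝ → M.H := fun τ => incl (M.expA₀ τ (M.A₀ e))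
  have hN : ∀ τ, M.semigroup τ (M.G 1) = N τ := fun τ => semigroup_G τ
  have hNd : ∀ τ, HasDerivAt N (N' τ) τ := fun τ =>
    incl.hasFDerivAt.comp_hasDerivAt τ
      ((ContinuousLinearMap.apply ℝ R2 e).hasFDerivAt.comp_hasDerivAt τ (M.hasDerivAt_expA₀ τ))
  have hN'c : Continuous N' :=
    incl.continuous.comp (M.continuous_expA₀.clm_apply continuous_const)
  obtain ⟨Cu, hCuc, hCua, hCuL, hCus, hCu⟩ :=
    hu.exists_conv ht (M.continuous_semigroup (M.B !₂[1, 0]))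
  obtain ⟨Cz, hCzc, hCza, hCzL, hCzs, hCz⟩ :=
    hz.exists_conv ht (M.continuous_semigroup (M.B !₂[0, 1]))
  obtain ⟨CX, hCXc, hCXa, hCXL, hCXs, hCX⟩ := hX.exists_conv ht hN'c
  -- partial integration turns the stochastic convolution into `X_s N(0) + ∫_t^s X_r N'(s - r) dr`
  set X : ℝ≥0 → Ω → ℝ := fun s ω => W' s ω - W' (min t s) ω with hXdef
  set Y : ℝ≥0 → Ω → M.H := fun s ω =>
    M.semigroup (s - t) y + (Cu s ω + Cz s ω) + (X s ω • N 0 + CX s ω) with hY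
  have hSc : Continuous fun s : ℝ≥0 => M.semigroup (s - t) y :=
    (M.continuous_semigroup y).comp (by fun_prop)
  have hYc : ∀ ω, Continuous (Y · ω) := fun ω =>
    (hSc.add ((hCuc ω).add (hCzc ω))).add (((hXc ω).smul continuous_const).add (hCXc ω))
  have hYa : StronglyAdapted (brownianFiltration P W hW) Y := fun s =>
    (stronglyMeasurable_const.add ((hCua s).add (hCza s))).add
      (((hXa s).smul_const _).add (hCXa s))
  have hsub : ((volume.restrict (Icc (t : ℝ) M.T)).prod P)
      ≤ ((volume.restrict (Icc (0 : ℝ) M.T)).prod P) :=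
    Measure.prod_mono (Measure.restrict_mono (Icc_subset_Icc_left t.2) le_rfl) le_rfl
  have hXN : ∀ {α : Type _} {mα : MeasurableSpace α} {μ : Measure α} {f : α → ℝ}, MemLp f 2 μ →
      MemLp (fun x => f x • N 0) 2 μ := fun hf =>
    (ContinuousLinearMap.toSpanSingleton ℝ (N 0)).comp_memLp' hf
  refine ⟨Y, hYa.isStronglyProgressive_of_continuous hYc,
    .of_forall fun ω => (hYc ω).continuousOn, ?_, ?_⟩
  · refine MemLp.add (MemLp.add ?_ (hCuL.add hCzL)) (MemLp.add ?_ hCXL)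
    · have hc : Continuous fun r : ℝ => M.semigroup (r.toNNReal - t) y :=
        hSc.comp continuous_real_toNNReal
      obtain ⟨D, hD⟩ := (isCompact_Icc (a := (t : ℝ)) (b := M.T)).exists_bound_of_continuousOn
        hc.continuousOn
      refine MemLp.of_bound (hc.stronglyMeasurable.comp_measurable
        measurable_fst).aestronglyMeasurable D ?_
      have h' := Measure.quasiMeasurePreserving_fst (μ := volume.restrict (Icc (t : ℝ) M.T))
        (ν := P) |>.ae (ae_restrict_mem measurableSet_Icc)
      filter_upwards [h'] with p hp using hD _ hp
    · exact hXN (hX.2.mono_measure hsub)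
  · intro s hs
    have hts : (t : ℝ) ≤ s := by exact_mod_cast hs.1
    have hPhi : ∀ r, HasDerivAt (fun r : ℝ => N (s - r)) (-N' (s - r)) r := fun r => by
      have h := (hNd (s - r)).scomp r ((hasDerivAt_id r).const_sub (s : ℝ))
      rw [neg_smul, one_smul] at h
      exact h
    have hXs : ∀ ω r, t ≤ r → X r ω = W' r ω - W' t ω := fun ω r hr => by
      rw [hXdef]; simp only [min_eq_left hr]
    set I : Ω → M.H := fun ω => (W' s ω - W' t ω) • N (s - s)
      - ∫ r in (t : ℝ)..s, (W' r.toNNReal ω - W' t ω) • (-N' (s - r)) with hI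
    have hIeq : ∀ᵐ ω ∂P, X s ω • N 0 + CX s ω = I ω := by
      filter_upwards [hCX] with ω hω
      rw [hω s hs, hI, hXs ω s hs.1]
      simp only [sub_self, smul_neg, intervalIntegral.integral_neg, sub_neg_eq_add]
      congr 1
      refine intervalIntegral.integral_congr fun r hr => ?_
      rw [uIcc_of_le hts] at hr
      have : t ≤ r.toNNReal := NNReal.le_toNNReal_of_coe_le hr.1
      change X r.toNNReal ω • N' (s - r) = _
      rw [hXs ω _ this]
    have hmemX : MemLp (X s) 2 P := by
      refine ((memLp_brownian_sub hW s t)).ae_eq ?_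
      filter_upwards [hWW] with ω hω
      rw [hXs ω s hs.1, hω, hω]
    have hmemI : MemLp I 2 P := ((hXN hmemX).add (hCXs s hs)).ae_eq hIeq
    refine ⟨I, ?_, ?_⟩
    · simp_rw [hN]
      exact isWienerIntegral_byParts hW hWc
        (fun s => ((hWa s).mono ((brownianFiltration P W hW).le s)).measurable) hWW hs.1 hPhi
        (hN'c.comp (continuous_sub_left (s : ℝ))).neg hmemI
    · filter_upwards [hIeq, hCu, hCz, ae_drift_eq hu hz t] with ω h1 h2 h3 h4
      rw [h4 s hs, ← h2 s hs, ← h3 s hs, ← h1]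

theorem isMildSolution_mildSolution (hW : IsBrownianReal W P) {t : ℝ≥0} (ht : t ≤ M.T) (y : M.H)
    {u z : ℝ≥0 → Ω → ℝ} (hu : M.Admissible P W hW u) (hz : M.Admissible P W hW z) :
    M.IsMildSolution P W hW t y (pair u z) (M.mildSolution P W hW t y (pair u z)) := by
  have h := exists_isMildSolution hW ht y hu hz
  unfold mildSolution
  rw [dif_pos h]
  exact h.choose_spec

/-- A mild solution is square integrable at each time, with the mean of the deterministic
equation driven by the mean of the control: the stochastic convolution has mean zero. -/
theorem IsMildSolution.memLp_and_integral {hW : IsBrownianReal W P} {t : ℝ≥0} {y : M.H}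
    {u z : ℝ≥0 → Ω → ℝ} (hu : M.Admissible P W hW u) (hz : M.Admissible P W hW z)
    {Y : ℝ≥0 → Ω → M.H} (hY : M.IsMildSolution P W hW t y (pair u z) Y) {s : ℝ≥0}
    (hs : s ∈ Icc t M.T) :
    MemLp (Y s) 2 P ∧ ∫ ω, Y s ω ∂P = M.semigroup (s - t) y
      + ((∫ r in (t : ℝ)..s, (∫ ω, u r.toNNReal ω ∂P) • M.semigroup (s - r) (M.B !₂[1, 0]))
        + ∫ r in (t : ℝ)..s, (∫ ω, z r.toNNReal ω ∂P) • M.semigroup (s - r) (M.B !₂[0, 1])) := by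
  have ht : t ≤ M.T := hs.1.trans hs.2
  obtain ⟨I, hI, hYI⟩ := hY.formula s hs
  have hS : ∀ h : M.H, Continuous fun r : ℝ => M.semigroup (s - r) h := fun h =>
    (M.continuous_semigroup h).comp (continuous_sub_left (s : ℝ))
  obtain ⟨Cu, -, -, -, hCus, hCu⟩ := hu.exists_conv ht (M.continuous_semigroup (M.B !₂[1, 0]))
  obtain ⟨Cz, -, -, -, hCzs, hCz⟩ := hz.exists_conv ht (M.continuous_semigroup (M.B !₂[0, 1]))
  have hYe : Y s =ᵐ[P] fun ω => M.semigroup (s - t) y + (Cu s ω + Cz s ω) + I ω := by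
    filter_upwards [hYI, hCu, hCz, ae_drift_eq hu hz t] with ω h1 h2 h3 h4
    rw [h1, h4 s hs, h2 s hs, h3 s hs]
  have hmean : ∀ (h : M.H) {U : ℝ≥0 → Ω → ℝ} {C : ℝ≥0 → Ω → M.H}, M.Admissible P W hW U →
      (∀ᵐ ω ∂P, ∀ s ∈ Icc t M.T,
        C s ω = ∫ r in (t : ℝ)..s, U r.toNNReal ω • M.semigroup (s - r) h) →
      ∫ ω, C s ω ∂P
        = ∫ r in (t : ℝ)..s, (∫ ω, U r.toNNReal ω ∂P) • M.semigroup (s - r) h := by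
    intro h U C hU hC
    rw [← hU.integral_integral_smul hs.1 hs.2 (hS h)]
    exact integral_congr_ae (by filter_upwards [hC] with ω hω using hω s hs)
  have h := memLp_and_integral_of_ae_eq (hCus s hs) (hCzs s hs) hI.2.1 (hI.integral_eq_zero hW) hYe
  rw [hmean _ hu hCu, hmean _ hz hCz] at h
  exact h

end Model

end MildSolution

/-! ### The adjoint equation and its kernel -/

section Kernel

/-- Fubini on the triangle `t < q < s < T`, for a convolution integrand. -/
theorem integral_triangle_swap {t T : ℝ} (htT : t ≤ T) {n h : ℝ → ℝ}
    (hn : IntegrableOn n (Ioc t T)) (hh : Continuous h) :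
    ∫ s in t..T, (∫ q in t..s, n q * h (s - q)) = ∫ q in t..T, n q * ∫ s in q..T, h (s - q) := by
  set μ : Measure ℝ := volume.restrict (Ioc t T)
  set F : ℝ × ℝ → ℝ := {p : ℝ × ℝ | p.2 ≤ p.1}.indicator fun p => n p.2 * h (p.1 - p.2) with hF
  obtain ⟨C, hC⟩ := (isCompact_Icc (a := t - T) (b := T - t)).exists_bound_of_continuousOn
    hh.continuousOn
  have hFi : Integrable F (μ.prod μ) := by
    refine Integrable.indicator ?_ (measurableSet_le measurable_snd measurable_fst)
    refine (hn.comp_snd μ).mul_bdd (c := C)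
      (hh.comp (continuous_fst.sub continuous_snd)).aestronglyMeasurable ?_
    have h1 := Measure.quasiMeasurePreserving_fst (μ := μ) (ν := μ)
      |>.ae (ae_restrict_mem measurableSet_Ioc)
    have h2 := Measure.quasiMeasurePreserving_snd (μ := μ) (ν := μ)
      |>.ae (ae_restrict_mem measurableSet_Ioc)
    filter_upwards [h1, h2] with p hp1 hp2
    exact hC _ ⟨by linarith [hp1.1, hp2.2], by linarith [hp1.2, hp2.1]⟩
  have hswap := integral_integral_swap (f := fun s q => F (s, q)) hFi
  rw [intervalIntegral.integral_of_le htT, intervalIntegral.integral_of_le htT]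
  convert hswap using 1
  · refine setIntegral_congr_fun measurableSet_Ioc fun s hs => ?_
    have h1 : (fun q => F (s, q)) = (Iic s).indicator fun q => n q * h (s - q) := rfl
    change _ = ∫ q in Ioc t T, (fun q => F (s, q)) q
    rw [h1, setIntegral_indicator measurableSet_Iic, Ioc_inter_Iic, min_eq_right hs.2]
    exact intervalIntegral.integral_of_le hs.1.le
  · refine setIntegral_congr_fun measurableSet_Ioc fun q hq => ?_
    have h1 : (fun s => F (s, q)) = (Ici q).indicator fun s => n q * h (s - q) := rfl
    change _ = ∫ s in Ioc t T, (fun s => F (s, q)) s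
    rw [h1, setIntegral_indicator measurableSet_Ici]
    have h2 : Ioc t T ∩ Ici q = Icc q T := by
      ext s
      simp only [mem_inter_iff, mem_Ioc, mem_Ici, mem_Icc]
      exact ⟨fun h => ⟨h.2, h.1.2⟩, fun h => ⟨⟨hq.1.trans_le h.1, h.2⟩, h.1⟩⟩
    rw [h2, integral_Icc_eq_integral_Ioc, integral_const_mul,
      ← intervalIntegral.integral_of_le hq.2]

namespace Model

variable (M : Model)

/-- The deterministic response of the reward `⟨x, Y₀⟩` to the initial state, after a time `τ`:
`⟨e^{τA*}(x,0), y⟩ = ⟨x, (e^{τA} y)₀⟩`. -/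
noncomputable def initResponse (y : M.H) (x : R2) (τ : ℝ) : ℝ :=
  inner ℝ (M.semigroupAdj τ (inState M.d x)) y

/-- The response, after a time `τ`, of the reward `⟨x, Y₀⟩` to a unit of both controls. -/
noncomputable def response (x : R2) (τ : ℝ) : ℝ :=
  M.initResponse (M.B !₂[1, 1]) x τ

theorem continuous_initResponse (y : M.H) (x : R2) : Continuous (M.initResponse y x) :=
  (M.continuous_semigroupAdj_inState x).inner continuous_const

theorem continuous_response (x : R2) : Continuous (M.response x) :=
  M.continuous_initResponse _ x

theorem inner_a (t : ℝ) (y : M.H) :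
    inner ℝ (M.a t) y = Real.exp (-M.r * (M.T - t)) * M.initResponse y M.lamt (M.T - t)
      + ∫ s in t..(M.T : ℝ), Real.exp (-M.r * (s - t)) * M.initResponse y M.αt (s - t) := by
  have hc : Continuous fun s : ℝ =>
      Real.exp (-M.r * (s - t)) • M.semigroupAdj (s - t) (inState M.d M.αt) :=
    (show Continuous fun s : ℝ => Real.exp (-M.r * (s - t)) by fun_prop).smul
      ((M.continuous_semigroupAdj_inState M.αt).comp (continuous_sub_right t))
  have h1 := (innerSL ℝ y).intervalIntegral_comp_comm (hc.intervalIntegrable (μ := volume) t M.T)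
  rw [a, inner_add_left, real_inner_smul_left, real_inner_comm y (∫ _ in _.._, _)]
  congr 1
  refine Eq.trans h1.symm (intervalIntegral.integral_congr fun s _ => ?_)
  simp only [innerSL_apply_apply, real_inner_smul_right]
  rw [real_inner_comm]
  rfl

/-- The pairing `⟨a(q), B(1,1)⟩ = ⟨B* a(q), (1,1)⟩`: the marginal reward, before
costs and discounted to time `q`, of a unit of both controls at time `q`. -/
noncomputable def shadow (q : ℝ) : ℝ := inner ℝ (M.a q) (M.B !₂[1, 1])

theorem shadow_eq (q : ℝ) :
    M.shadow q = Real.exp (-M.r * (M.T - q)) * M.response M.lamt (M.T - q)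
      + ∫ s in q..(M.T : ℝ), Real.exp (-M.r * (s - q)) * M.response M.αt (s - q) :=
  M.inner_a q _

theorem continuous_shadow : Continuous M.shadow := by
  have h : ∀ q, ∫ s in q..(M.T : ℝ), Real.exp (-M.r * (s - q)) * M.response M.αt (s - q)
      = ∫ τ in (0 : ℝ)..(M.T - q), Real.exp (-M.r * τ) * M.response M.αt τ := by
    intro q
    rw [intervalIntegral.integral_comp_sub_right
      (fun τ => Real.exp (-M.r * τ) * M.response M.αt τ) q, sub_self]
  have hc : Continuous fun τ => Real.exp (-M.r * τ) * M.response M.αt τ :=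
    Continuous.mul (by fun_prop) (M.continuous_response _)
  have hp : Continuous fun x : ℝ => ∫ τ in (0 : ℝ)..x, Real.exp (-M.r * τ) * M.response M.αt τ :=
    intervalIntegral.continuous_primitive (fun _ _ => hc.intervalIntegrable _ _) 0
  have heq : M.shadow = fun q => Real.exp (-M.r * (M.T - q)) * M.response M.lamt (M.T - q)
      + ∫ τ in (0 : ℝ)..(M.T - q), Real.exp (-M.r * τ) * M.response M.αt τ := by
    ext q
    rw [shadow_eq, h]
  rw [heq]
  exact (Continuous.mul (by fun_prop)
    ((M.continuous_response _).comp (by fun_prop))).add (hp.comp (continuous_sub_left _))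

theorem inner_Badj_a_sub (q : ℝ) :
    inner ℝ (M.Badj (M.a q) - M.βt) (!₂[1, 1] : R2) = M.shadow q - (M.β₀ + M.β₁) := by
  rw [inner_sub_left, ← inner_B, shadow]
  congr 1
  simp [βt, PiLp.inner_apply, Fin.sum_univ_two]

theorem ustar_Badj_a (q : ℝ) :
    M.ustar (M.Badj (M.a q)) = (M.shadow q - (M.β₀ + M.β₁)) / (2 * (M.γ₀ + M.γ₁)) := by
  rw [ustar, inner_Badj_a_sub]

/-- The value of the linear part of the reward, in terms of the adjoint state: the contribution of
the control `m` at time `q` to all later rewards is collected in `shadow q`. -/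
theorem linear_reward_eq {t : ℝ} (ht : t ≤ M.T) (y : M.H) {m : ℝ → ℝ}
    (hm : IntegrableOn m (Ioc t M.T)) :
    (∫ s in t..(M.T : ℝ), Real.exp (-M.r * (s - t)) *
        (M.initResponse y M.αt (s - t) + ∫ q in t..s, m q * M.response M.αt (s - q)))
      + Real.exp (-M.r * (M.T - t)) *
        (M.initResponse y M.lamt (M.T - t) + ∫ q in t..(M.T : ℝ), m q * M.response M.lamt (M.T - q))
      = inner ℝ (M.a t) y
        + ∫ q in t..(M.T : ℝ), Real.exp (-M.r * (q - t)) * (m q * M.shadow q) := by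
  have hmi : IntervalIntegrable m volume t M.T :=
    (intervalIntegrable_iff_integrableOn_Ioc_of_le ht).2 hm
  set n : ℝ → ℝ := fun q => Real.exp (-M.r * (q - t)) * m q with hn
  set h : ℝ → ℝ := fun τ => Real.exp (-M.r * τ) * M.response M.αt τ with hh
  have hexp : ∀ s q : ℝ, Real.exp (-M.r * (s - t))
      = Real.exp (-M.r * (q - t)) * Real.exp (-M.r * (s - q)) := by
    intro s q
    rw [← Real.exp_add]
    congr 1
    ring
  have hhc : Continuous h := Continuous.mul (by fun_prop) (M.continuous_response _)
  have hni : IntervalIntegrable n volume t M.T :=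
    hmi.continuousOn_mul (Continuous.continuousOn (by fun_prop))
  have hnI : IntegrableOn n (Ioc t M.T) :=
    (intervalIntegrable_iff_integrableOn_Ioc_of_le ht).1 hni
  have hinner : ∀ s, Real.exp (-M.r * (s - t)) * ∫ q in t..s, m q * M.response M.αt (s - q)
      = ∫ q in t..s, n q * h (s - q) := by
    intro s
    rw [← intervalIntegral.integral_const_mul]
    refine intervalIntegral.integral_congr fun q _ => ?_
    simp only [hn, hh]
    rw [hexp s q]
    ring
  have hconv : IntervalIntegrable (fun s => ∫ q in t..s, n q * h (s - q)) volume t M.T := by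
    refine ((continuous_conv hnI hhc).intervalIntegrable t M.T).congr ?_
    refine fun s hs => ?_
    rw [uIoc_of_le ht] at hs
    exact conv_eq_intervalIntegral ⟨hs.1.le, hs.2⟩ _ _
  have hinit : IntervalIntegrable
      (fun s => Real.exp (-M.r * (s - t)) * M.initResponse y M.αt (s - t)) volume t M.T :=
    (Continuous.mul (by fun_prop) ((M.continuous_initResponse y _).comp
      (continuous_sub_right t))).intervalIntegrable _ _
  have hlam : IntervalIntegrable (fun q => n q *
      (Real.exp (-M.r * (M.T - q)) * M.response M.lamt (M.T - q))) volume t M.T :=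
    hni.mul_continuousOn (Continuous.mul (by fun_prop)
      ((M.continuous_response _).comp (continuous_sub_left _))).continuousOn
  have htail : IntervalIntegrable (fun q => n q * ∫ s in q..(M.T : ℝ), h (s - q)) volume t M.T := by
    refine hni.mul_continuousOn (Continuous.continuousOn ?_)
    have hp : Continuous fun x : ℝ => ∫ τ in (0 : ℝ)..x, h τ :=
      intervalIntegral.continuous_primitive (fun _ _ => hhc.intervalIntegrable _ _) 0
    refine (hp.comp (continuous_sub_left (M.T : ℝ))).congr fun q => ?_
    rw [intervalIntegral.integral_comp_sub_right h q, sub_self]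
    rfl
  have hlam_eq : Real.exp (-M.r * (M.T - t))
        * ∫ q in t..(M.T : ℝ), m q * M.response M.lamt (M.T - q)
      = ∫ q in t..(M.T : ℝ), n q * (Real.exp (-M.r * (M.T - q)) * M.response M.lamt (M.T - q)) := by
    rw [← intervalIntegral.integral_const_mul]
    refine intervalIntegral.integral_congr fun q _ => ?_
    simp only [hn]
    rw [hexp M.T q]
    ring
  have hshadow : ∫ q in t..(M.T : ℝ), Real.exp (-M.r * (q - t)) * (m q * M.shadow q)
      = (∫ q in t..(M.T : ℝ), n q * (Real.exp (-M.r * (M.T - q)) * M.response M.lamt (M.T - q)))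
        + ∫ q in t..(M.T : ℝ), n q * ∫ s in q..(M.T : ℝ), h (s - q) := by
    rw [← intervalIntegral.integral_add hlam htail]
    refine intervalIntegral.integral_congr fun q _ => ?_
    simp only [hn, hh, shadow_eq]
    ring
  simp_rw [mul_add, hinner]
  rw [intervalIntegral.integral_add hinit hconv, integral_triangle_swap ht hnI hhc, hlam_eq,
    hshadow, inner_a]
  ring

end Model

end Kernel

/-! ### The reward functional -/

section Reward

namespace Model

variable {M : Model}

variable (M) in
theorem f_pair (x : R2) (p q : ℝ) :
    M.f x !₂[p, q] = inner ℝ M.αt x - (M.β₀ * p + M.γ₀ * p ^ 2 + M.β₁ * q + M.γ₁ * q ^ 2) := by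
  simp [f, αt, PiLp.inner_apply, Fin.sum_univ_two]
  ring

variable (M) in
theorem g_eq (x : R2) : M.g x = inner ℝ M.lamt x := by
  simp [g, lamt, PiLp.inner_apply, Fin.sum_univ_two]
  ring

variable (M) in
/-- The functional `y ↦ ⟨x, y₀⟩` on the state space. -/
noncomputable def presentInner (x : R2) : M.H →L[ℝ] ℝ :=
  (innerSL ℝ x) ∘L (WithLp.fstL 2 ℝ R2 (Lp R2 2 (delayMeasure M.d)))

theorem presentInner_apply (x : R2) (y : M.H) : M.presentInner x y = inner ℝ x y.fst := rfl

theorem presentInner_semigroup (x : R2) (τ : ℝ) (y : M.H) :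
    M.presentInner x (M.semigroup τ y) = M.initResponse y x τ :=
  (M.inner_semigroupAdj_inState τ x y).symm

variable {Ω : Type*} [MeasurableSpace Ω] {P : Measure Ω} {W : ℝ≥0 → Ω → ℝ}
  [IsProbabilityMeasure P] [P.IsComplete]

theorem Admissible.integrable_sq {hW : IsBrownianReal W P} {U : ℝ≥0 → Ω → ℝ}
    (hU : M.Admissible P W hW U) (t : ℝ≥0) :
    Integrable (fun p : ℝ × Ω => U p.1.toNNReal p.2 ^ 2)
      ((volume.restrict (Ioc (t : ℝ) M.T)).prod P) :=
  (hU.memLp_Ioc t le_rfl).integrable_sq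

theorem Admissible.integrable {hW : IsBrownianReal W P} {U : ℝ≥0 → Ω → ℝ}
    (hU : M.Admissible P W hW U) (t : ℝ≥0) :
    Integrable (fun p : ℝ × Ω => U p.1.toNNReal p.2)
      ((volume.restrict (Ioc (t : ℝ) M.T)).prod P) :=
  (hU.memLp_Ioc t le_rfl).integrable (by norm_num)

theorem IsMildSolution.integrable_reward {hW : IsBrownianReal W P} {t : ℝ≥0} {y : M.H}
    {u z : ℝ≥0 → Ω → ℝ} (hu : M.Admissible P W hW u) (hz : M.Admissible P W hW z)
    {Y : ℝ≥0 → Ω → M.H} (hY : M.IsMildSolution P W hW t y (pair u z) Y) :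
    Integrable (fun p : ℝ × Ω => Real.exp (-M.r * (p.1 - t))
      * M.f (Y p.1.toNNReal p.2).fst (pair u z p.1.toNNReal p.2))
      ((volume.restrict (Ioc (t : ℝ) M.T)).prod P) := by
  have hx : Integrable (fun p : ℝ × Ω => M.presentInner M.αt (Y p.1.toNNReal p.2))
      ((volume.restrict (Ioc (t : ℝ) M.T)).prod P) := by
    have h1 := (hY.memLp.mono_measure (Measure.prod_mono
      (Measure.restrict_mono Ioc_subset_Icc_self le_rfl) (le_refl P)))
    exact ((M.presentInner M.αt).comp_memLp' h1).integrable (by norm_num)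
  obtain ⟨C, hC⟩ := (isCompact_Icc (a := (t : ℝ)) (b := M.T)).exists_bound_of_continuousOn
    (f := fun s : ℝ => Real.exp (-M.r * (s - t))) (by fun_prop)
  refine Integrable.bdd_mul (c := C) ?_
    (Measurable.aestronglyMeasurable (by fun_prop)) ?_
  · simp only [pair, f_pair]
    exact hx.sub (((((hu.integrable t).const_mul _).add ((hu.integrable_sq t).const_mul _)).add
      ((hz.integrable t).const_mul _)).add ((hz.integrable_sq t).const_mul _))
  · have h1 := Measure.quasiMeasurePreserving_fst (μ := volume.restrict (Ioc (t : ℝ) M.T)) (ν := P)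
      |>.ae (ae_restrict_mem measurableSet_Ioc)
    filter_upwards [h1] with p hp using hC _ ⟨hp.1.le, hp.2⟩

theorem wellPosed (hW : IsBrownianReal W P) {t : ℝ≥0} (ht : t ≤ M.T) (y : M.H)
    {u z : ℝ≥0 → Ω → ℝ} (hu : M.Admissible P W hW u) (hz : M.Admissible P W hW z) :
    M.WellPosed P W hW t y (pair u z) := by
  have hY := isMildSolution_mildSolution hW ht y hu hz
  refine ⟨hY, ?_, ?_⟩
  · rw [← restrict_Ioc_eq_restrict_Icc]
    exact hY.integrable_reward hu hz
  · simp only [g_eq]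
    exact ((M.presentInner M.lamt).comp_memLp'
      (hY.memLp_and_integral hu hz ⟨ht, le_rfl⟩).1).integrable (by norm_num)

/-- The mean of the reward `⟨x, Y₀(s)⟩` depends on the control through its mean only. -/
theorem IsMildSolution.integral_presentInner {hW : IsBrownianReal W P} {t : ℝ≥0} {y : M.H}
    {u : ℝ≥0 → Ω → ℝ} (hu : M.Admissible P W hW u)
    {Y : ℝ≥0 → Ω → M.H} (hY : M.IsMildSolution P W hW t y (pair u u) Y) {s : ℝ≥0}
    (hs : s ∈ Icc t M.T) (x : R2) :
    Integrable (fun ω => M.presentInner x (Y s ω)) P ∧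
    ∫ ω, M.presentInner x (Y s ω) ∂P = M.initResponse y x (s - t)
      + ∫ q in (t : ℝ)..s, (∫ ω, u q.toNNReal ω ∂P) * M.response x (s - q) := by
  obtain ⟨hmem, hmean⟩ := hY.memLp_and_integral hu hu hs
  have hts : (t : ℝ) ≤ s := by exact_mod_cast hs.1
  have hi : Integrable (Y s) P := hmem.integrable (by norm_num)
  refine ⟨(M.presentInner x).integrable_comp hi, ?_⟩
  have hm : IntervalIntegrable (fun q => ∫ ω, u q.toNNReal ω ∂P) volume t s :=
    (intervalIntegrable_iff_integrableOn_Ioc_of_le hts).2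
      ((hu.memLp_Ioc t hs.2).integrable (by norm_num)).integral_prod_left
  have hk : ∀ h : M.H, IntervalIntegrable
      (fun q => (∫ ω, u q.toNNReal ω ∂P) • M.semigroup (s - q) h) volume t s := fun h =>
    hm.smul_continuousOn
      ((M.continuous_semigroup h).comp (continuous_sub_left (s : ℝ))).continuousOn
  have hk' : ∀ h : M.H, M.presentInner x
      (∫ q in (t : ℝ)..s, (∫ ω, u q.toNNReal ω ∂P) • M.semigroup (s - q) h)
      = ∫ q in (t : ℝ)..s, (∫ ω, u q.toNNReal ω ∂P) * M.initResponse h x (s - q) := by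
    intro h
    rw [← (M.presentInner x).intervalIntegral_comp_comm (hk h)]
    refine intervalIntegral.integral_congr fun q _ => ?_
    simp only [map_smul, smul_eq_mul, presentInner_semigroup]
  have hr : ∀ h : M.H, IntervalIntegrable
      (fun q => (∫ ω, u q.toNNReal ω ∂P) * M.initResponse h x (s - q)) volume t s := fun h =>
    hm.mul_continuousOn ((M.continuous_initResponse h x).comp (continuous_sub_left _)).continuousOn
  rw [(M.presentInner x).integral_comp_comm hi, hmean, map_add, map_add, hk', hk',
    presentInner_semigroup, ← intervalIntegral.integral_add (hr _) (hr _)]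
  congr 1
  refine intervalIntegral.integral_congr fun q _ => ?_
  have hB : M.B !₂[1, 1] = M.B !₂[1, 0] + M.B !₂[0, 1] := by
    rw [M.B_pair 1 1, one_smul, one_smul]
  simp only [response, initResponse, hB, inner_add_right]
  ring

/-- The reward of a control `(u, u)` in terms of the first two moments of `u`. -/
theorem J_eq {hW : IsBrownianReal W P} {t : ℝ≥0} (ht : t ≤ M.T) (y : M.H)
    {u : ℝ≥0 → Ω → ℝ} (hu : M.Admissible P W hW u) :
    M.J P W hW t y (pair u u) = inner ℝ (M.a t) y
      + ∫ q in (t : ℝ)..M.T, Real.exp (-M.r * (q - t)) *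
        ((M.shadow q - (M.β₀ + M.β₁)) * (∫ ω, u q.toNNReal ω ∂P)
          - (M.γ₀ + M.γ₁) * ∫ ω, u q.toNNReal ω ^ 2 ∂P) := by
  have ht' : (t : ℝ) ≤ M.T := by exact_mod_cast ht
  have hY := isMildSolution_mildSolution hW ht y hu hu
  have hRi := hY.integrable_reward hu hu
  unfold J
  set Y := M.mildSolution P W hW t y (pair u u) with hYdef
  have hterm := hY.integral_presentInner hu ⟨ht, le_rfl⟩ M.lamt
  set m : ℝ → ℝ := fun q => ∫ ω, u q.toNNReal ω ∂P with hm
  set w : ℝ → ℝ := fun q => ∫ ω, u q.toNNReal ω ^ 2 ∂P with hw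
  have hmI : IntegrableOn m (Ioc (t : ℝ) M.T) := (hu.integrable t).integral_prod_left
  have hwI : IntegrableOn w (Ioc (t : ℝ) M.T) := (hu.integrable_sq t).integral_prod_left
  have hmi : IntervalIntegrable m volume t M.T :=
    (intervalIntegrable_iff_integrableOn_Ioc_of_le ht').2 hmI
  have hwi : IntervalIntegrable w volume t M.T :=
    (intervalIntegrable_iff_integrableOn_Ioc_of_le ht').2 hwI
  have hexp : Continuous fun q : ℝ => Real.exp (-M.r * (q - t)) := by fun_prop
  -- the mean of the running reward at a fixed time
  have hmean : ∀ᵐ s ∂(volume.restrict (Ioc (t : ℝ) M.T)),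
      ∫ ω, Real.exp (-M.r * (s - t)) * M.f (Y s.toNNReal ω).fst (pair u u s.toNNReal ω) ∂P
        = Real.exp (-M.r * (s - t)) * (M.initResponse y M.αt (s - t)
            + ∫ q in (t : ℝ)..s, m q * M.response M.αt (s - q))
          - Real.exp (-M.r * (s - t)) * ((M.β₀ + M.β₁) * m s + (M.γ₀ + M.γ₁) * w s) := by
    filter_upwards [ae_restrict_mem measurableSet_Ioc, (hu.integrable t).prod_right_ae,
      (hu.integrable_sq t).prod_right_ae] with s hs h1 h2
    have hs0 : ((s.toNNReal : ℝ≥0) : ℝ) = s := Real.coe_toNNReal _ (t.2.trans hs.1.le)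
    have hsm : s.toNNReal ∈ Icc t M.T :=
      ⟨NNReal.le_toNNReal_of_coe_le hs.1.le, Real.toNNReal_le_iff_le_coe.2 hs.2⟩
    obtain ⟨h3, h4⟩ := hY.integral_presentInner hu hsm M.αt
    rw [hs0] at h4
    have hsplit : ∀ ω, M.f (Y s.toNNReal ω).fst (pair u u s.toNNReal ω)
        = M.presentInner M.αt (Y s.toNNReal ω)
          - ((M.β₀ + M.β₁) * u s.toNNReal ω + (M.γ₀ + M.γ₁) * u s.toNNReal ω ^ 2) := by
      intro ω
      simp only [pair, f_pair, presentInner_apply]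
      ring
    simp_rw [hsplit]
    have h5 : Integrable (fun ω => (M.β₀ + M.β₁) * u s.toNNReal ω
        + (M.γ₀ + M.γ₁) * u s.toNNReal ω ^ 2) P := (h1.const_mul _).add (h2.const_mul _)
    rw [integral_const_mul, integral_sub h3 h5,
      integral_add (h1.const_mul _) (h2.const_mul _), integral_const_mul, integral_const_mul, h4]
    ring
  have hrun : ∫ ω, (∫ s in (t : ℝ)..M.T, Real.exp (-M.r * (s - t))
        * M.f (Y s.toNNReal ω).fst (pair u u s.toNNReal ω)) ∂P
      = ∫ s in (t : ℝ)..M.T, (Real.exp (-M.r * (s - t)) * (M.initResponse y M.αt (s - t)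
            + ∫ q in (t : ℝ)..s, m q * M.response M.αt (s - q))
          - Real.exp (-M.r * (s - t)) * ((M.β₀ + M.β₁) * m s + (M.γ₀ + M.γ₁) * w s)) := by
    simp_rw [intervalIntegral.integral_of_le ht']
    rw [← integral_congr_ae hmean]
    exact (integral_integral_swap hRi).symm
  have hrunI : Integrable (fun ω => ∫ s in (t : ℝ)..M.T, Real.exp (-M.r * (s - t))
        * M.f (Y s.toNNReal ω).fst (pair u u s.toNNReal ω)) P := by
    simp_rw [intervalIntegral.integral_of_le ht']
    exact hRi.integral_prod_right
  have hcost : IntervalIntegrable (fun s => Real.exp (-M.r * (s - t)) *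
      ((M.β₀ + M.β₁) * m s + (M.γ₀ + M.γ₁) * w s)) volume t M.T :=
    ((hmi.const_mul _).add (hwi.const_mul _)).continuousOn_mul hexp.continuousOn
  have hlin : IntervalIntegrable (fun s => Real.exp (-M.r * (s - t)) *
      (M.initResponse y M.αt (s - t) + ∫ q in (t : ℝ)..s, m q * M.response M.αt (s - q)))
      volume t M.T := by
    refine IntervalIntegrable.continuousOn_mul ?_ hexp.continuousOn
    refine IntervalIntegrable.add (((M.continuous_initResponse y _).comp
      (continuous_sub_right (t : ℝ))).intervalIntegrable _ _) ?_
    refine ((continuous_conv hmI (M.continuous_response M.αt)).intervalIntegrable t M.T).congr ?_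
    intro s hs
    rw [uIoc_of_le ht'] at hs
    exact conv_eq_intervalIntegral ⟨hs.1.le, hs.2⟩ _ _
  have hsh : IntervalIntegrable (fun q => Real.exp (-M.r * (q - t)) * (m q * M.shadow q))
      volume t M.T :=
    (hmi.mul_continuousOn M.continuous_shadow.continuousOn).continuousOn_mul hexp.continuousOn
  simp_rw [g_eq, ← presentInner_apply]
  rw [integral_add hrunI (hterm.1.const_mul _), integral_const_mul, hterm.2, hrun,
    intervalIntegral.integral_sub hlin hcost, sub_add_eq_add_sub, M.linear_reward_eq ht' y hmI,
    add_sub_assoc, ← intervalIntegral.integral_sub hsh hcost]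
  congr 1
  refine intervalIntegral.integral_congr fun q _ => ?_
  ring

variable (M) in
theorem v_eq (t : ℝ) (y : M.H) : M.v t y = inner ℝ (M.a t) y
    + ∫ q in t..(M.T : ℝ), Real.exp (-M.r * (q - t))
      * ((M.shadow q - (M.β₀ + M.β₁)) ^ 2 / (4 * (M.γ₀ + M.γ₁))) := by
  simp only [v, b, inner_Badj_a_sub]

/-- Completing the square: no control does better than `v`. -/
theorem J_le_v (hγ : 0 < M.γ₀ + M.γ₁) {hW : IsBrownianReal W P} {t : ℝ≥0} (ht : t ≤ M.T) (y : M.H)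
    {u : ℝ≥0 → Ω → ℝ} (hu : M.Admissible P W hW u) :
    M.J P W hW t y (pair u u) ≤ M.v t y := by
  have ht' : (t : ℝ) ≤ M.T := by exact_mod_cast ht
  have hexp : Continuous fun q : ℝ => Real.exp (-M.r * (q - t)) := by fun_prop
  have hc : Continuous fun q : ℝ => M.shadow q - (M.β₀ + M.β₁) :=
    M.continuous_shadow.sub continuous_const
  rw [J_eq ht y hu, v_eq]
  gcongr
  refine intervalIntegral.integral_mono_ae_restrict ht' ?_ ?_ ?_
  · have hmi : IntervalIntegrable (fun q => ∫ ω, u q.toNNReal ω ∂P) volume t M.T :=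
      (intervalIntegrable_iff_integrableOn_Ioc_of_le ht').2 (hu.integrable t).integral_prod_left
    have hwi : IntervalIntegrable (fun q => ∫ ω, u q.toNNReal ω ^ 2 ∂P) volume t M.T :=
      (intervalIntegrable_iff_integrableOn_Ioc_of_le ht').2 (hu.integrable_sq t).integral_prod_left
    exact ((hmi.continuousOn_mul hc.continuousOn).sub (hwi.const_mul _)).continuousOn_mul
      hexp.continuousOn
  · exact (hexp.mul ((hc.pow 2).div_const _)).intervalIntegrable _ _
  · rw [← restrict_Ioc_eq_restrict_Icc]
    filter_upwards [(hu.integrable t).prod_right_ae, (hu.integrable_sq t).prod_right_ae]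
      with q h1 h2
    refine mul_le_mul_of_nonneg_left ?_ (Real.exp_nonneg _)
    have hL2 : MemLp (u q.toNNReal) 2 P := (memLp_two_iff_integrable_sq h1.1).2 h2
    have hJensen := variance_nonneg (u q.toNNReal) P
    rw [variance_eq_sub hL2] at hJensen
    simp only [Pi.pow_apply] at hJensen
    generalize M.shadow q - (M.β₀ + M.β₁) = c
    generalize (∫ ω, u q.toNNReal ω ∂P) = m at hJensen ⊢
    -- `4γ (c m - γ w) = c² - (c - 2γm)² - 4γ² (w - m²)`, where `γ = γ₀ + γ₁` and `m`, `w` are the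
    -- first two moments of the control
    rw [le_div_iff₀ (by positivity)]
    nlinarith [sq_nonneg (c - 2 * (M.γ₀ + M.γ₁) * m), mul_nonneg (sq_nonneg (M.γ₀ + M.γ₁)) hJensen]

theorem admissible_uOpt (hW : IsBrownianReal W P) (t : ℝ≥0) :
    M.Admissible P W hW (M.uOpt Ω t) := by
  have hc : Continuous fun s : ℝ => M.ustar (M.Badj (M.a s)) := by
    simp only [ustar_Badj_a]
    exact (M.continuous_shadow.sub continuous_const).div_const _
  have hm : Measurable ((Icc t M.T).indicator fun s : ℝ≥0 => M.ustar (M.Badj (M.a s))) :=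
    (hc.comp NNReal.continuous_coe).measurable.indicator measurableSet_Icc
  refine ⟨fun i => ?_, ?_⟩
  · exact hm.stronglyMeasurable.comp_measurable (measurable_subtype_coe.comp measurable_fst)
  · obtain ⟨C, hC⟩ := (isCompact_Icc (a := (t : ℝ)) (b := M.T)).exists_bound_of_continuousOn
      hc.continuousOn
    refine MemLp.of_bound (hm.stronglyMeasurable.comp_measurable
      measurable_fst.real_toNNReal).aestronglyMeasurable (max C 0) (.of_forall fun p => ?_)
    simp only [uOpt]
    by_cases h : p.1.toNNReal ∈ Icc t M.T
    · rw [indicator_of_mem h]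
      exact (hC _ ⟨by exact_mod_cast h.1, by exact_mod_cast h.2⟩).trans (le_max_left _ _)
    · rw [indicator_of_notMem h, norm_zero]
      exact le_max_right _ _

theorem J_uOpt (hγ : 0 < M.γ₀ + M.γ₁) (hW : IsBrownianReal W P) {t : ℝ≥0} (ht : t ≤ M.T)
    (y : M.H) : M.J P W hW t y (pair (M.uOpt Ω t) (M.uOpt Ω t)) = M.v t y := by
  have ht' : (t : ℝ) ≤ M.T := by exact_mod_cast ht
  rw [J_eq ht y (admissible_uOpt hW t), v_eq]
  congr 1
  refine intervalIntegral.integral_congr fun q hq => ?_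
  rw [uIcc_of_le ht'] at hq
  have hq0 : ((q.toNNReal : ℝ≥0) : ℝ) = q := Real.coe_toNNReal _ (t.2.trans hq.1)
  have hqm : q.toNNReal ∈ Icc t M.T :=
    ⟨NNReal.le_toNNReal_of_coe_le hq.1, Real.toNNReal_le_iff_le_coe.2 hq.2⟩
  have hval : ∀ ω : Ω, M.uOpt Ω t q.toNNReal ω
      = (M.shadow q - (M.β₀ + M.β₁)) / (2 * (M.γ₀ + M.γ₁)) := by
    intro ω
    rw [uOpt, indicator_of_mem hqm, hq0, ustar_Badj_a]
  simp only [hval, integral_const, probReal_univ, one_smul]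
  field_simp
  ring

theorem V_le_v (hγ : 0 < M.γ₀ + M.γ₁) (hW : IsBrownianReal W P) {t : ℝ≥0} (ht : t ≤ M.T)
    (y : M.H) : M.V P W hW t y ≤ (M.v t y : EReal) := by
  refine sSup_le ?_
  rintro _ ⟨u, z, hu, -, rfl, rfl⟩
  exact EReal.coe_le_coe_iff.2 (J_le_v hγ ht y hu)

end Model

end Reward

end AdvertisingLQ

theorem mainTheorem1 (M : AdvertisingLQ.Model)
    (hd : 0 < M.d) (hb₀ : 0 ≤ M.b₀) (hb₁ : 0 ≤ M.b₁) (hγ₀ : 0 < M.γ₀) (hγ₁ : 0 < M.γ₁)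
    {Ω : Type*} [MeasurableSpace Ω] (P : Measure Ω) [IsProbabilityMeasure P] [P.IsComplete]
    (W : ℝ≥0 → Ω → ℝ) (hW : IsBrownianReal W P) :
    (∀ t ≤ M.T, ∀ (y : M.H) (u z : ℝ≥0 → Ω → ℝ),
      M.Admissible P W hW u → M.Admissible P W hW z →
        M.WellPosed P W hW t y (AdvertisingLQ.Model.pair u z)) ∧
    (∀ t ≤ M.T, ∀ y : M.H, M.V P W hW t y ≤ (M.v t y : EReal)) ∧
    (∀ t ≤ M.T, ∀ y : M.H,
      M.Admissible P W hW (M.uOpt Ω t) ∧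
      M.V P W hW t y = (M.v t y : EReal) ∧
      M.v t y = M.J P W hW t y (AdvertisingLQ.Model.pair (M.uOpt Ω t) (M.uOpt Ω t))) := by
  have hγ : 0 < M.γ₀ + M.γ₁ := add_pos hγ₀ hγ₁
  refine ⟨fun t ht y u z hu hz => AdvertisingLQ.Model.wellPosed hW ht y hu hz,
    fun t ht y => AdvertisingLQ.Model.V_le_v hγ hW ht y, fun t ht y => ?_⟩
  have hadm := AdvertisingLQ.Model.admissible_uOpt (M := M) hW t
  have hJ := AdvertisingLQ.Model.J_uOpt hγ hW ht y
  refine ⟨hadm, le_antisymm (AdvertisingLQ.Model.V_le_v hγ hW ht y) ?_, hJ.symm⟩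
  rw [← hJ]
  exact le_sSup ⟨_, _, hadm, hadm, rfl, rfl⟩
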